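/- Let $D(u)=u^2+\sin u$ and $g(u)=u+\sin u$, and consider the problem $$[D(u(t))u'(t)]'+\lambda g(u(t))=0,\quad u(t)>0\quad (0<t<1),\qquad u(0)=u(1)=0,$$ where $\lambda>0$ and $u\in C^2(0,1)\cap C[0,1]$. For every $\alpha>0$ there is exactly one $\lambda=\lambda(\alpha)>0$ for which this problem has a solution $u$ with $\|u\|_\infty=\max_{0\le t\le 1}|u(t)|=\alpha$, and this function $\lambda(\alpha)$ satisfies the following. (i) As $\alpha\to\infty$, $$\lambda(\alpha)=8\alpha^2\left\{A_{2,2}^2-A_{2,2}\sqrt{\pi}\,\alpha^{-3/2}\sin\left(\alpha-\frac{\pi}{4}\right)+o(\alpha^{-3/2})\right\},\qquad A_{2,2}=\int_0^1\frac{s^2}{\sqrt{1-s^4}}\,ds.$$ (ii) As $\alpha\to 0^+$, $$\lambda(\alpha)=3\alpha\left(C_0^2+2C_0C_1\alpha+O(\alpha^2)\right),$$ where $$C_0=\int_0^1\frac{s}{\sqrt{1-s^3}}\,ds,\qquad C_1=\int_0^1\frac{1}{\sqrt{1-s^3}}\left(s^2-\frac{3s(1-s^4)}{8(1-s^3)}\right)ds.$$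 -/

import Mathlib

open Filter Topology Asymptotics

noncomputable section

/-- `(u, lam)` solves the problem `[D(u(t)) u'(t)]' + lam * g(u(t)) = 0`, `u(t) > 0` for
`0 < t < 1`, `u(0) = u(1) = 0`, with `lam > 0` and `u` of class `C²(0,1) ∩ C[0,1]`. -/
structure IsSolutionPair (D g : ℝ → ℝ) (u : ℝ → ℝ) (lam : ℝ) : Prop where
  param_pos : 0 < lam
  continuousOn : ContinuousOn u (Set.Icc 0 1)
  contDiffOn : ContDiffOn ℝ 2 u (Set.Ioo 0 1)
  equation : ∀ t ∈ Set.Ioo (0 : ℝ) 1,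
    HasDerivAt (fun s => D (u s) * deriv u s) (-(lam * g (u t))) t
  pos : ∀ t ∈ Set.Ioo (0 : ℝ) 1, 0 < u t
  left_boundary : u 0 = 0
  right_boundary : u 1 = 0

/-- `α` is the sup norm of `u` on the interval `[0,1]`. -/
def IsSupNorm (u : ℝ → ℝ) (α : ℝ) : Prop :=
  IsLUB ((fun t => |u t|) '' Set.Icc 0 1) α

/-- `lam` is the bifurcation curve `α ↦ lam α` (`α > 0`) of the problem with diffusion `D` and
nonlinearity `g`: for each `α > 0`, the number `lam α` is the one and only parameter for which
the problem has a solution of sup norm `α`. Values of `lam` at `α ≤ 0` are irrelevant. -/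
def IsBifurcationCurve (D g : ℝ → ℝ) (lam : ℝ → ℝ) : Prop :=
  ∀ α : ℝ, 0 < α → ∀ μ : ℝ, (∃ u : ℝ → ℝ, IsSolutionPair D g u μ ∧ IsSupNorm u α) ↔ μ = lam α

/-- `A_{k,m} = ∫₀¹ s^k / √(1 - s^{2m}) ds`. -/
def constA (k m : ℕ) : ℝ := ∫ s in (0 : ℝ)..1, s ^ k / √(1 - s ^ (2 * m))

/-- `C₀ = ∫₀¹ s / √(1 - s³) ds`. -/
def constC₀ : ℝ := ∫ s in (0 : ℝ)..1, s / √(1 - s ^ 3)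

/-- `C₁ = ∫₀¹ (1 / √(1 - s³)) (s² - 3 s (1 - s⁴) / (8 (1 - s³))) ds`. -/
def constC₁ : ℝ := ∫ s in (0 : ℝ)..1,
  1 / √(1 - s ^ 3) * (s ^ 2 - 3 * s * (1 - s ^ 4) / (8 * (1 - s ^ 3)))

end

/-!
The equation is conservative: along a solution, with `w = D(u) u'` and `G(u) = ∫₀ᵘ D g`, the
energy `w² / 2 + lam * G(u)` is constant. A solution of amplitude `α` therefore lies on the level
`q² + G(u) = G(α)`, where `q = w / √(2 lam)` is the normalised momentum. On this level `u` is a `C¹`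
function `V(q)` of `q`, also at the maximum `q = 0`, and `q' = -√(lam / 2) g(V(q))`. So a primitive
`τ` of `1 / g(V(q))` is a clock which runs at the constant speed `-√(lam / 2)` along every solution,
while `q` decreases from `√G(α)` to `-√G(α)`. The substitution `u = V(q)` shows that the increment
of `τ` is the time map `T(α) = ∫₀^α D / √(G(α) - G)`. Hence `lam = 2 T(α)²` is necessary
(`IsAdmissible.param_eq_of_isSolutionPair`), and inverting the clock gives a solution for this value
(`IsAdmissible.exists_isSolutionPair`). It remains to expand `T`.

For small `α`, `G(α) - G(α s) = (2/3) α³ (1 - s³) (1 + ρ)` with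
`ρ = (3/4) α (1 - s⁴) / (1 - s³) + O(α²)`, uniformly in `s`. Expanding `1 / √(1 + ρ)` to first order
leaves errors with an integrable singularity `1 / √(1 - s)` (`exists_abs_timeMap_small_sub_le`).

For large `α`, `G(α) - G(α s) = (α⁴/4) (1 - s⁴) (1 + ρ)` with
`ρ = -4 α⁻² (cos α - cos (α s)) / (1 - s⁴) + O(α⁻²)`, which is `O(α⁻¹)`. The quadratic term in `ρ`
and the oscillating part of `D` both contribute `O(α⁻²)`, so that
`T(α) / (2α) = A + 2 α⁻² J(α) + O(α⁻²)` with the integral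
`J(α) = ∫₀¹ s² (cos α - cos (α s)) / (1 - s⁴) ^ (3/2) ds` (`exists_abs_timeMap_large_sub_le`). The
substitution `s = 1 - x² / α` and dominated convergence reduce `J(α) / √α` to the integrals of
`(1 - cos x²) / x²` and `sin x² / x²` over the half line, both equal to `√(π/2)`
(`tendsto_oscIntegral`). These are limits of Gaussian integrals with complex parameter
(`integral_fresnel_I`).
-/

open MeasureTheory Set

/-! ### Phase plane of the equation -/

/-- A strictly increasing continuous function on a compact interval has an inverse which extends
continuously to the whole line. -/
theorem exists_continuous_rightInverse {f : ℝ → ℝ} {a b : ℝ} (hab : a ≤ b)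
    (hf : StrictMonoOn f (Icc a b)) (hc : ContinuousOn f (Icc a b)) :
    ∃ V : ℝ → ℝ, Continuous V ∧ ∀ y ∈ Icc (f a) (f b), V y ∈ Icc a b ∧ f (V y) = y := by
  have him : f '' Icc a b = Icc (f a) (f b) := by
    apply Subset.antisymm
    · rintro _ ⟨x, hx, rfl⟩
      exact ⟨hf.monotoneOn (left_mem_Icc.2 hab) hx hx.1, hf.monotoneOn hx (right_mem_Icc.2 hab) hx.2⟩
    · exact intermediate_value_Icc hab hc
  have hfab : f a ≤ f b := hf.monotoneOn (left_mem_Icc.2 hab) (right_mem_Icc.2 hab) hab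
  let e : Icc a b ≃o Icc (f a) (f b) :=
    (hf.orderIso f (Icc a b)).trans (OrderIso.setCongr _ _ him)
  have he : ∀ x : Icc a b, (e x : ℝ) = f x := fun x => rfl
  refine ⟨IccExtend hfab (fun y => (e.symm y : ℝ)), ?_, ?_⟩
  · exact (continuous_subtype_val.comp e.symm.continuous).Icc_extend'
  · intro y hy
    rw [IccExtend_of_mem _ _ hy]
    refine ⟨(e.symm ⟨y, hy⟩).2, ?_⟩
    rw [← he, OrderIso.apply_symm_apply]

noncomputable section

/-- The standing assumptions on the diffusion `D` and the nonlinearity `g`. -/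
structure IsAdmissible (D g : ℝ → ℝ) : Prop where
  contDiff : ContDiff ℝ 1 D
  continuous : Continuous g
  D_pos : ∀ x, 0 < x → 0 < D x
  g_pos : ∀ x, 0 < x → 0 < g x

/-- The potential `G(u) = ∫₀ᵘ D g`. Along a solution, `(D(u) u')² / 2 + lam * G(u)` is constant. -/
def potential (D g : ℝ → ℝ) (u : ℝ) : ℝ := ∫ x in (0 : ℝ)..u, D x * g x

/-- The time map `T(α) = ∫₀^α D / √(G(α) - G)`. -/
def timeMap (D g : ℝ → ℝ) (α : ℝ) : ℝ :=
  ∫ v in (0 : ℝ)..α, D v / √(potential D g α - potential D g v)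

end

section TimeMap

variable {D g : ℝ → ℝ}

theorem potential_zero : potential D g 0 = 0 := intervalIntegral.integral_same

theorem IsAdmissible.hasDerivAt_potential (h : IsAdmissible D g) (x : ℝ) :
    HasDerivAt (potential D g) (D x * g x) x :=
  ((h.contDiff.continuous.mul h.continuous).integral_hasStrictDerivAt 0 x).hasDerivAt

theorem IsAdmissible.continuous_potential (h : IsAdmissible D g) : Continuous (potential D g) :=
  continuous_iff_continuousAt.2 fun x => (h.hasDerivAt_potential x).continuousAt

theorem IsAdmissible.strictMonoOn_potential (h : IsAdmissible D g) :
    StrictMonoOn (potential D g) (Ici 0) := by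
  apply strictMonoOn_of_deriv_pos (convex_Ici 0) h.continuous_potential.continuousOn
  intro x hx
  rw [interior_Ici] at hx
  rw [(h.hasDerivAt_potential x).deriv]
  exact mul_pos (h.D_pos x hx) (h.g_pos x hx)

theorem IsAdmissible.potential_pos (h : IsAdmissible D g) {x : ℝ} (hx : 0 < x) :
    0 < potential D g x := by
  have := h.strictMonoOn_potential (mem_Ici.2 le_rfl) (mem_Ici.2 hx.le) hx
  rwa [potential_zero] at this

/-- The state `V(q)` on the energy level of amplitude `α` as a function of the normalised momentum
`q`: `G(V(q)) + q² = G(α)`. It is differentiable also at `q = 0`, where the maximum is attained. -/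
theorem IsAdmissible.exists_state (h : IsAdmissible D g) {α : ℝ} (hα : 0 < α) :
    ∃ V : ℝ → ℝ, Continuous V ∧
      (∀ q, q ^ 2 ≤ potential D g α →
        V q ∈ Icc 0 α ∧ potential D g (V q) = potential D g α - q ^ 2) ∧
      ∀ q, q ^ 2 < potential D g α →
        0 < V q ∧ HasDerivAt V (-(2 * q) / (D (V q) * g (V q))) q := by
  have hmono := h.strictMonoOn_potential
  -- Inverting the potential beyond `α` makes `G(α)` an interior point of the range.
  obtain ⟨W, hWc, hW⟩ := exists_continuous_rightInverse (f := potential D g) (a := 0) (b := α + 1)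
    (by linarith) (hmono.mono Icc_subset_Ici_self) h.continuous_potential.continuousOn
  have hlt : potential D g α < potential D g (α + 1) :=
    hmono (mem_Ici.2 hα.le) (mem_Ici.2 (by linarith)) (by linarith)
  rw [potential_zero] at hW
  have key : ∀ q, q ^ 2 ≤ potential D g α →
      W (potential D g α - q ^ 2) ∈ Icc 0 α ∧
        potential D g (W (potential D g α - q ^ 2)) = potential D g α - q ^ 2 := by
    intro q hq
    obtain ⟨h1, h2⟩ := hW (potential D g α - q ^ 2) ⟨by linarith, by nlinarith⟩
    refine ⟨⟨h1.1, ?_⟩, h2⟩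
    rw [← hmono.le_iff_le (mem_Ici.2 h1.1) (mem_Ici.2 hα.le), h2]
    nlinarith
  refine ⟨fun q => W (potential D g α - q ^ 2), by fun_prop, key, ?_⟩
  intro q hq
  obtain ⟨h1, h2⟩ := key q hq.le
  have hpos : 0 < W (potential D g α - q ^ 2) := by
    rw [← hmono.lt_iff_lt (mem_Ici.2 le_rfl) (mem_Ici.2 h1.1), h2, potential_zero]
    linarith
  refine ⟨hpos, ?_⟩
  have hne : D (W (potential D g α - q ^ 2)) * g (W (potential D g α - q ^ 2)) ≠ 0 :=
    (mul_pos (h.D_pos _ hpos) (h.g_pos _ hpos)).ne'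
  have hd : HasDerivAt W (D (W (potential D g α - q ^ 2)) * g (W (potential D g α - q ^ 2)))⁻¹
      (potential D g α - q ^ 2) := by
    apply HasDerivAt.of_local_left_inverse hWc.continuousAt (h.hasDerivAt_potential _) hne
    have : Ioo 0 (potential D g (α + 1)) ∈ 𝓝 (potential D g α - q ^ 2) :=
      Ioo_mem_nhds (by linarith) (by nlinarith)
    filter_upwards [this] with y hy
    exact (hW y ⟨hy.1.le, hy.2.le⟩).2
  have hq' : HasDerivAt (fun q : ℝ => potential D g α - q ^ 2) (-(2 * q)) q := by
    simpa using (hasDerivAt_pow 2 q).const_sub (potential D g α)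
  have := hd.comp q hq'
  rw [div_eq_inv_mul]
  exact this

/-- The substitution `q = √(G(α) - G(v))` turns the time map into the integral of `2 / g(V(q))`. -/
theorem IsAdmissible.integral_momentum (h : IsAdmissible D g) {α : ℝ} (hα : 0 < α)
    (hint : IntervalIntegrable (fun v => D v / √(potential D g α - potential D g v)) volume 0 α)
    {V : ℝ → ℝ}
    (hV : ∀ q, q ^ 2 ≤ potential D g α →
        V q ∈ Icc 0 α ∧ potential D g (V q) = potential D g α - q ^ 2) :
    IntegrableOn (fun q => 1 / g (V q)) (Ioo 0 √(potential D g α)) ∧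
      2 * ∫ q in Ioo 0 √(potential D g α), 1 / g (V q) = timeMap D g α := by
  have hmono := h.strictMonoOn_potential
  set f : ℝ → ℝ := fun v => √(potential D g α - potential D g v) with hf
  have hlt : ∀ v ∈ Ioo 0 α, potential D g v < potential D g α := fun v hv =>
    hmono (mem_Ici.2 hv.1.le) (mem_Ici.2 hα.le) hv.2
  have hVf : ∀ v ∈ Ioo 0 α, V (f v) = v := by
    intro v hv
    have hsq : f v ^ 2 = potential D g α - potential D g v :=
      Real.sq_sqrt (by linarith [hlt v hv])
    have h0 := h.potential_pos hv.1
    obtain ⟨h1, h2⟩ := hV (f v) (by linarith)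
    apply hmono.injOn (mem_Ici.2 h1.1) (mem_Ici.2 hv.1.le)
    linarith
  have himage : f '' Ioo 0 α = Ioo 0 √(potential D g α) := by
    ext q
    constructor
    · rintro ⟨v, hv, rfl⟩
      exact ⟨Real.sqrt_pos.2 (by linarith [hlt v hv]),
        Real.sqrt_lt_sqrt (by linarith [hlt v hv]) (by linarith [h.potential_pos hv.1])⟩
    · rintro ⟨h0, h1⟩
      have hq : q ^ 2 < potential D g α := (Real.lt_sqrt h0.le).1 h1
      obtain ⟨h2, h3⟩ := hV q hq.le
      refine ⟨V q, ⟨?_, ?_⟩, ?_⟩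
      · rw [← hmono.lt_iff_lt (mem_Ici.2 le_rfl) (mem_Ici.2 h2.1), h3, potential_zero]
        linarith
      · rw [← hmono.lt_iff_lt (mem_Ici.2 h2.1) (mem_Ici.2 hα.le), h3]
        nlinarith
      · simp only [hf, h3, sub_sub_cancel, Real.sqrt_sq h0.le]
  have hinj : InjOn f (Ioo 0 α) := by
    intro x hx y hy hxy
    rw [← hVf x hx, ← hVf y hy, hxy]
  have hderiv : ∀ v ∈ Ioo 0 α, HasDerivWithinAt f (-(D v * g v) / (2 * f v)) (Ioo 0 α) v := by
    intro v hv
    have := ((h.hasDerivAt_potential v).const_sub (potential D g α)).sqrt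
      (by linarith [hlt v hv])
    exact this.hasDerivWithinAt
  have hcongr : ∀ v ∈ Ioo 0 α, |-(D v * g v) / (2 * f v)| • (1 / g (V (f v)))
      = (1 / 2) * (D v / √(potential D g α - potential D g v)) := by
    intro v hv
    have hfpos : 0 < f v := Real.sqrt_pos.2 (by linarith [hlt v hv])
    have hg := h.g_pos v hv.1
    have hD := h.D_pos v hv.1
    rw [hVf v hv, neg_div, abs_neg, abs_of_pos (by positivity), smul_eq_mul]
    change _ = (1 / 2) * (D v / f v)
    field_simp
  rw [← himage]
  have hint' : IntegrableOn (fun v => D v / √(potential D g α - potential D g v)) (Ioo 0 α) :=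
    (intervalIntegrable_iff_integrableOn_Ioo_of_le hα.le).1 hint
  constructor
  · rw [integrableOn_image_iff_integrableOn_abs_deriv_smul measurableSet_Ioo hderiv hinj]
    exact (IntegrableOn.congr_fun (hint'.const_mul (1 / 2)) (fun v hv => (hcongr v hv).symm)
      measurableSet_Ioo)
  · rw [integral_image_eq_integral_abs_deriv_smul measurableSet_Ioo hderiv hinj,
      setIntegral_congr_fun measurableSet_Ioo hcongr, integral_const_mul, timeMap,
      intervalIntegral.integral_of_le hα.le, integral_Ioc_eq_integral_Ioo]
    ring

/-- The clock on the orbit of amplitude `α`: a primitive of `1 / g(V(q))` in the momentum `q`. Its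
total increment over the orbit is the time map. -/
theorem IsAdmissible.exists_clock (h : IsAdmissible D g) {α : ℝ} (hα : 0 < α)
    (hint : IntervalIntegrable (fun v => D v / √(potential D g α - potential D g v)) volume 0 α)
    {V : ℝ → ℝ} (hVc : Continuous V)
    (hV : ∀ q, q ^ 2 ≤ potential D g α →
        V q ∈ Icc 0 α ∧ potential D g (V q) = potential D g α - q ^ 2)
    (hV0 : ∀ q, q ^ 2 < potential D g α → 0 < V q) :
    ∃ τ : ℝ → ℝ, ContinuousOn τ (Icc (-√(potential D g α)) √(potential D g α)) ∧
      (∀ q, q ^ 2 < potential D g α → HasDerivAt τ (1 / g (V q)) q) ∧ τ 0 = 0 ∧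
      τ √(potential D g α) = timeMap D g α / 2 ∧ τ (-√(potential D g α)) = -(timeMap D g α / 2) := by
  obtain ⟨hI, hT⟩ := h.integral_momentum hα hint hV
  set P := √(potential D g α) with hP
  have hPpos : 0 < P := Real.sqrt_pos.2 (h.potential_pos hα)
  have hP2 : P ^ 2 = potential D g α := Real.sq_sqrt (h.potential_pos hα).le
  have hright : IntervalIntegrable (fun q => 1 / g (V q)) volume 0 P :=
    (intervalIntegrable_iff_integrableOn_Ioo_of_le hPpos.le).2 hI
  have heven : ∀ q ∈ uIcc 0 P, 1 / g (V (-q)) = 1 / g (V q) := by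
    intro q hq
    rw [uIcc_of_le hPpos.le] at hq
    have hq2 : q ^ 2 ≤ potential D g α := by rw [← hP2]; exact pow_le_pow_left₀ hq.1 hq.2 2
    obtain ⟨h1, h2⟩ := hV q hq2
    obtain ⟨h3, h4⟩ := hV (-q) (by rwa [neg_sq])
    rw [neg_sq] at h4
    rw [h.strictMonoOn_potential.injOn (mem_Ici.2 h3.1) (mem_Ici.2 h1.1) (by rw [h2, h4])]
  have hleft : IntervalIntegrable (fun q => 1 / g (V q)) volume (-P) 0 := by
    have h1 : IntervalIntegrable (fun q => 1 / g (V (-q))) volume 0 P :=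
      hright.congr_uIoo fun q hq => (heven q (Ioo_subset_Icc_self hq)).symm
    have := (IntervalIntegrable.iff_comp_neg (f := fun q => 1 / g (V (-q)))).1 h1
    simpa using this.symm
  have hall : IntervalIntegrable (fun q => 1 / g (V q)) volume (-P) P := hleft.trans hright
  have hval : ∫ q in (0 : ℝ)..P, 1 / g (V q) = timeMap D g α / 2 := by
    rw [intervalIntegral.integral_of_le hPpos.le, integral_Ioc_eq_integral_Ioo, ← hT]
    ring
  refine ⟨fun x => ∫ q in (0 : ℝ)..x, 1 / g (V q), ?_, ?_, intervalIntegral.integral_same, hval, ?_⟩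
  · have := intervalIntegral.continuousOn_primitive_interval' hall
      (by rw [uIcc_of_le (by linarith)]; exact ⟨by linarith, hPpos.le⟩ : (0 : ℝ) ∈ uIcc (-P) P)
    rwa [uIcc_of_le (by linarith)] at this
  · intro q hq
    have hqP : |q| < P := by
      rw [← abs_of_pos hPpos]; exact sq_lt_sq.1 (by rwa [hP2])
    rw [abs_lt] at hqP
    have hmeas : Measurable fun q => 1 / g (V q) :=
      measurable_const.div (h.continuous.comp hVc).measurable
    apply intervalIntegral.integral_hasDerivAt_right
    · apply hall.mono_set
      rw [uIcc_of_le (by linarith : -P ≤ P)]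
      exact uIcc_subset_Icc ⟨by linarith, hPpos.le⟩ ⟨hqP.1.le, hqP.2.le⟩
    · exact hmeas.stronglyMeasurable.stronglyMeasurableAtFilter
    · exact continuousAt_const.div (h.continuous.comp hVc).continuousAt
        (h.g_pos _ (hV0 q hq)).ne'
  · change ∫ q in (0 : ℝ)..(-P), 1 / g (V q) = _
    rw [← hval, intervalIntegral.integral_symm, neg_inj]
    have := intervalIntegral.integral_comp_neg (a := 0) (b := P) (fun q => 1 / g (V q))
    rw [neg_zero] at this
    rw [← this]
    exact intervalIntegral.integral_congr heven

end TimeMap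

section BifurcationCurve

variable {D g : ℝ → ℝ}

/-- Every solution of amplitude `α` traverses the whole orbit of energy `G(α)`, so the clock
determines its parameter. -/
theorem IsAdmissible.param_eq_of_isSolutionPair (h : IsAdmissible D g) {α : ℝ} (hα : 0 < α)
    (hint : IntervalIntegrable (fun v => D v / √(potential D g α - potential D g v)) volume 0 α)
    {u : ℝ → ℝ} {μ : ℝ} (hu : IsSolutionPair D g u μ) (hs : IsSupNorm u α) :
    μ = 2 * timeMap D g α ^ 2 := by
  obtain ⟨V, hVc, hV, hV'⟩ := h.exists_state hα
  obtain ⟨τ, hτc, hτ, -, hτP, hτN⟩ := h.exists_clock hα hint hVc hV fun q hq => (hV' q hq).1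
  set P := √(potential D g α) with hP
  have hPpos : 0 < P := Real.sqrt_pos.2 (h.potential_pos hα)
  have hP2 : P ^ 2 = potential D g α := Real.sq_sqrt (h.potential_pos hα).le
  have hμ := hu.param_pos
  have hnonneg : ∀ t ∈ Icc (0 : ℝ) 1, 0 ≤ u t := by
    intro t ht
    rcases eq_or_lt_of_le ht.1 with h0 | h0
    · rw [← h0, hu.left_boundary]
    rcases eq_or_lt_of_le ht.2 with h1 | h1
    · rw [h1, hu.right_boundary]
    exact (hu.pos t ⟨h0, h1⟩).le
  have hle : ∀ t ∈ Icc (0 : ℝ) 1, u t ≤ α := fun t ht =>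
    (le_abs_self _).trans (hs.1 ⟨t, ht, rfl⟩)
  -- The maximum is attained in the interior.
  obtain ⟨t₀, ht₀, hut₀⟩ : ∃ t ∈ Ioo (0 : ℝ) 1, u t = α := by
    obtain ⟨t, ht, hmax⟩ := isCompact_Icc.exists_isMaxOn (nonempty_Icc.2 zero_le_one) hu.continuousOn
    have hut : u t = α := by
      apply le_antisymm (hle t ht)
      apply hs.2
      rintro _ ⟨x, hx, rfl⟩
      change |u x| ≤ u t
      rw [abs_of_nonneg (hnonneg x hx)]
      exact hmax hx
    refine ⟨t, ⟨lt_of_le_of_ne ht.1 ?_, lt_of_le_of_ne ht.2 ?_⟩, hut⟩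
    · rintro rfl
      rw [hu.left_boundary] at hut
      exact hα.ne hut
    · rintro rfl
      rw [hu.right_boundary] at hut
      exact hα.ne hut
  have hud : ∀ t ∈ Ioo (0 : ℝ) 1, HasDerivAt u (deriv u t) t := fun t ht =>
    ((hu.contDiffOn.differentiableOn (by norm_num)).differentiableAt
      (isOpen_Ioo.mem_nhds ht)).hasDerivAt
  have hcrit : deriv u t₀ = 0 := by
    apply IsLocalMax.deriv_eq_zero
    filter_upwards [isOpen_Ioo.mem_nhds ht₀] with t ht
    rw [hut₀]
    exact hle t (Ioo_subset_Icc_self ht)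
  -- The normalised momentum.
  set c := √(2 * μ) with hc
  have hcpos : 0 < c := Real.sqrt_pos.2 (by positivity)
  have hc2 : c ^ 2 = 2 * μ := Real.sq_sqrt (by positivity)
  set p : ℝ → ℝ := fun t => D (u t) * deriv u t / c with hpdef
  have hp : ∀ t ∈ Ioo (0 : ℝ) 1, HasDerivAt p (-(μ * g (u t)) / c) t := fun t ht =>
    (hu.equation t ht).div_const c
  have hp₀ : p t₀ = 0 := by simp [hpdef, hcrit]
  have hDu : ∀ t, D (u t) * deriv u t = c * p t := by
    intro t
    simp only [hpdef]
    field_simp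
  have henergy : ∀ t ∈ Ioo (0 : ℝ) 1, p t ^ 2 + potential D g (u t) = potential D g α := by
    intro t ht
    have hd : ∀ t ∈ Ioo (0 : ℝ) 1,
        HasDerivAt (fun t => p t ^ 2 + potential D g (u t)) 0 t := by
      intro t ht
      have := ((hp t ht).pow 2).add ((h.hasDerivAt_potential (u t)).comp t (hud t ht))
      convert! this using 1
      have h1 : D (u t) * g (u t) * deriv u t = g (u t) * (c * p t) := by rw [← hDu]; ring
      rw [h1]
      have h2 : μ = c ^ 2 / 2 := by rw [hc2]; ring
      rw [h2]
      field_simp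
      push_cast
      ring
    have := isOpen_Ioo.is_const_of_deriv_eq_zero isPreconnected_Ioo
      (fun t ht => (hd t ht).differentiableAt.differentiableWithinAt)
      (fun t ht => (hd t ht).deriv) ht ht₀
    simpa [hp₀, hut₀] using this
  have hplt : ∀ t ∈ Ioo (0 : ℝ) 1, p t ^ 2 < potential D g α := fun t ht => by
    linarith [henergy t ht, h.potential_pos (hu.pos t ht)]
  have hVp : ∀ t ∈ Ioo (0 : ℝ) 1, V (p t) = u t := by
    intro t ht
    obtain ⟨h1, h2⟩ := hV (p t) (hplt t ht).le
    apply h.strictMonoOn_potential.injOn (mem_Ici.2 h1.1) (mem_Ici.2 (hu.pos t ht).le)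
    linarith [henergy t ht]
  have hanti : StrictAntiOn p (Ioo 0 1) := by
    apply strictAntiOn_of_deriv_neg (convex_Ioo 0 1)
      fun t ht => (hp t ht).continuousAt.continuousWithinAt
    intro t ht
    rw [interior_Ioo] at ht
    rw [(hp t ht).deriv]
    have := h.g_pos _ (hu.pos t ht)
    exact div_neg_of_neg_of_pos (neg_neg_of_pos (by positivity)) hcpos
  -- The clock runs at constant speed along the solution.
  obtain ⟨K, hK⟩ : ∃ K, ∀ t ∈ Ioo (0 : ℝ) 1, τ (p t) + μ / c * t = K := by
    have hd : ∀ t ∈ Ioo (0 : ℝ) 1, HasDerivAt (fun t => τ (p t) + μ / c * t) 0 t := by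
      intro t ht
      have := ((hτ (p t) (hplt t ht)).comp t (hp t ht)).add
        ((hasDerivAt_id t).const_mul (μ / c))
      convert! this using 1
      rw [hVp t ht]
      have := (h.g_pos _ (hu.pos t ht)).ne'
      field_simp
      ring
    exact isOpen_Ioo.exists_is_const_of_deriv_eq_zero isPreconnected_Ioo
      (fun t ht => (hd t ht).differentiableAt.differentiableWithinAt)
      (fun t ht => (hd t ht).deriv)
  have habs : ∀ t ∈ Ioo (0 : ℝ) 1, |p t| = √(potential D g α - potential D g (u t)) := by
    intro t ht
    rw [← henergy t ht, add_sub_cancel_right, Real.sqrt_sq_eq_abs]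
  have hmem : ∀ t ∈ Ioo (0 : ℝ) 1, p t ∈ Icc (-P) P := by
    intro t ht
    rw [mem_Icc, ← abs_le, habs t ht]
    exact Real.sqrt_le_sqrt (by linarith [h.potential_pos (hu.pos t ht)])
  -- At both end points `u` vanishes, hence the modulus of the momentum tends to `P`.
  have hlim : ∀ (x : ℝ), x ∈ Icc (0 : ℝ) 1 → u x = 0 →
      Tendsto (fun t => |p t|) (𝓝[Ioo 0 1] x) (𝓝 P) := by
    intro x hx hux
    have h1 : Tendsto u (𝓝[Ioo 0 1] x) (𝓝 0) := by
      have := (hu.continuousOn x hx).mono Ioo_subset_Icc_self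
      rwa [ContinuousWithinAt, hux] at this
    have h2 : Tendsto (fun t => √(potential D g α - potential D g (u t))) (𝓝[Ioo 0 1] x)
        (𝓝 √(potential D g α - potential D g 0)) :=
      ((continuous_const.sub h.continuous_potential).sqrt.tendsto 0).comp h1
    rw [potential_zero, sub_zero] at h2
    apply h2.congr'
    filter_upwards [self_mem_nhdsWithin] with t ht
    exact (habs t ht).symm
  have hτlim : ∀ {x y : ℝ}, y ∈ Icc (-P) P → Tendsto p (𝓝[Ioo 0 1] x) (𝓝 y) →
      Tendsto (fun t => τ (p t) + μ / c * t) (𝓝[Ioo 0 1] x) (𝓝 (τ y + μ / c * x)) := by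
    intro x y hy hxy
    have h1 : Tendsto p (𝓝[Ioo 0 1] x) (𝓝[Icc (-P) P] y) :=
      tendsto_nhdsWithin_iff.2 ⟨hxy, by filter_upwards [self_mem_nhdsWithin] using hmem⟩
    have h2 : Tendsto (fun t : ℝ => μ / c * t) (𝓝[Ioo 0 1] x) (𝓝 (μ / c * x)) :=
      ((continuous_const.mul continuous_id).tendsto x).mono_left nhdsWithin_le_nhds
    exact ((hτc y hy).tendsto.comp h1).add h2
  have hKlim : ∀ (x : ℝ), Tendsto (fun t => τ (p t) + μ / c * t) (𝓝[Ioo 0 1] x) (𝓝 K) := by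
    intro x
    apply tendsto_const_nhds.congr'
    filter_upwards [self_mem_nhdsWithin] with t ht
    exact (hK t ht).symm
  have hleft : τ P + μ / c * 0 = K := by
    have : (𝓝[Ioo 0 1] (0 : ℝ)).NeBot := left_nhdsWithin_Ioo_neBot zero_lt_one
    refine tendsto_nhds_unique (hτlim ⟨by linarith, le_rfl⟩ ?_) (hKlim 0)
    apply (hlim 0 ⟨le_rfl, zero_le_one⟩ hu.left_boundary).congr'
    have : Iio t₀ ∈ 𝓝[Ioo 0 1] (0 : ℝ) := mem_nhdsWithin_of_mem_nhds (Iio_mem_nhds ht₀.1)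
    filter_upwards [self_mem_nhdsWithin, this] with t ht ht'
    exact abs_of_pos (hp₀ ▸ hanti ht ht₀ ht')
  have hright : τ (-P) + μ / c * 1 = K := by
    have : (𝓝[Ioo 0 1] (1 : ℝ)).NeBot := right_nhdsWithin_Ioo_neBot zero_lt_one
    refine tendsto_nhds_unique (hτlim ⟨le_rfl, by linarith⟩ ?_) (hKlim 1)
    apply (hlim 1 ⟨zero_le_one, le_rfl⟩ hu.right_boundary).neg.congr'
    have : Ioi t₀ ∈ 𝓝[Ioo 0 1] (1 : ℝ) := mem_nhdsWithin_of_mem_nhds (Ioi_mem_nhds ht₀.2)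
    filter_upwards [self_mem_nhdsWithin, this] with t ht ht'
    rw [abs_of_neg (hp₀ ▸ hanti ht₀ ht ht'), neg_neg]
  have hT : μ / c = timeMap D g α := by
    rw [hτP] at hleft
    rw [hτN] at hright
    linarith
  rw [← hT, div_pow, hc2]
  field_simp

/-- The clock has positive speed, so it can be inverted; this produces a solution of amplitude `α`
whose momentum passes through the orbit from `P` to `-P`. -/
theorem IsAdmissible.exists_isSolutionPair (h : IsAdmissible D g) {α : ℝ} (hα : 0 < α)
    (hint : IntervalIntegrable (fun v => D v / √(potential D g α - potential D g v)) volume 0 α) :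
    ∃ u : ℝ → ℝ, IsSolutionPair D g u (2 * timeMap D g α ^ 2) ∧ IsSupNorm u α := by
  obtain ⟨V, hVc, hV, hV'⟩ := h.exists_state hα
  obtain ⟨τ, hτc, hτ, hτ0, hτP, hτN⟩ := h.exists_clock hα hint hVc hV fun q hq => (hV' q hq).1
  set P := √(potential D g α) with hP
  have hPpos : 0 < P := Real.sqrt_pos.2 (h.potential_pos hα)
  have hP2 : P ^ 2 = potential D g α := Real.sq_sqrt (h.potential_pos hα).le
  set T := timeMap D g α with hTdef
  have hmono : StrictMonoOn τ (Icc (-P) P) := by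
    apply strictMonoOn_of_deriv_pos (convex_Icc _ _) hτc
    intro q hq
    rw [interior_Icc] at hq
    have hq2 : q ^ 2 < potential D g α := by rw [← hP2]; exact sq_lt_sq' hq.1 hq.2
    rw [(hτ q hq2).deriv]
    exact one_div_pos.2 (h.g_pos _ (hV' q hq2).1)
  have hN : -P ∈ Icc (-P) P := ⟨le_rfl, by linarith⟩
  have hR : P ∈ Icc (-P) P := ⟨by linarith, le_rfl⟩
  have hTpos : 0 < T := by
    have := hmono hN hR (by linarith)
    linarith
  obtain ⟨S, hSc, hS⟩ := exists_continuous_rightInverse (by linarith : -P ≤ P) hmono hτc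
  rw [hτP, hτN] at hS
  set p : ℝ → ℝ := fun t => S (T / 2 - T * t) with hpdef
  have hpc : Continuous p := by fun_prop
  have hp : ∀ t ∈ Icc (0 : ℝ) 1, p t ∈ Icc (-P) P ∧ τ (p t) = T / 2 - T * t := fun t ht =>
    hS _ ⟨by nlinarith [ht.2], by nlinarith [ht.1]⟩
  have hp2 : ∀ t ∈ Icc (0 : ℝ) 1, p t ^ 2 ≤ potential D g α := fun t ht => by
    rw [← hP2]; exact sq_le_sq' (hp t ht).1.1 (hp t ht).1.2
  have hplt : ∀ t ∈ Ioo (0 : ℝ) 1, p t ^ 2 < potential D g α := by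
    intro t ht
    obtain ⟨h1, h2⟩ := hp t (Ioo_subset_Icc_self ht)
    rw [← hP2]
    apply sq_lt_sq'
    · apply lt_of_le_of_ne h1.1
      intro h3
      rw [← h3, hτN] at h2
      nlinarith [ht.2]
    · apply lt_of_le_of_ne h1.2
      intro h3
      rw [h3, hτP] at h2
      nlinarith [ht.1]
  set u : ℝ → ℝ := fun t => V (p t) with hudef
  have huc : Continuous u := hVc.comp hpc
  have hupos : ∀ t ∈ Ioo (0 : ℝ) 1, 0 < u t := fun t ht => (hV' _ (hplt t ht)).1
  have hpd : ∀ t ∈ Ioo (0 : ℝ) 1, HasDerivAt p (-(T * g (u t))) t := by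
    intro t ht
    have hg := (h.g_pos _ (hupos t ht)).ne'
    have hSd : HasDerivAt S (1 / g (u t))⁻¹ (T / 2 - T * t) := by
      apply HasDerivAt.of_local_left_inverse hSc.continuousAt (hτ _ (hplt t ht))
        (one_div_ne_zero hg)
      have : Ioo (-(T / 2)) (T / 2) ∈ 𝓝 (T / 2 - T * t) :=
        Ioo_mem_nhds (by nlinarith [ht.2]) (by nlinarith [ht.1])
      filter_upwards [this] with y hy
      exact (hS y ⟨hy.1.le, hy.2.le⟩).2
    have hl : HasDerivAt (fun t : ℝ => T / 2 - T * t) (-T) t := by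
      simpa using ((hasDerivAt_id t).const_mul T).const_sub (T / 2)
    have := hSd.comp t hl
    convert! this using 1
    rw [one_div, inv_inv]
    ring
  have hud : ∀ t ∈ Ioo (0 : ℝ) 1, HasDerivAt u (2 * T * p t / D (u t)) t := by
    intro t ht
    have := (hV' _ (hplt t ht)).2.comp t (hpd t ht)
    convert! this using 1
    have hg := (h.g_pos _ (hupos t ht)).ne'
    have hD := (h.D_pos _ (hupos t ht)).ne'
    change _ = -(2 * p t) / (D (u t) * g (u t)) * -(T * g (u t))
    field_simp
  have hpC : ContDiffOn ℝ 1 p (Ioo 0 1) := by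
    rw [show (1 : WithTop ℕ∞) = 0 + 1 from rfl, contDiffOn_succ_iff_deriv_of_isOpen isOpen_Ioo]
    refine ⟨fun t ht => (hpd t ht).differentiableAt.differentiableWithinAt, by simp, ?_⟩
    rw [contDiffOn_zero]
    apply (continuous_const.mul (h.continuous.comp huc)).neg.continuousOn.congr
    exact fun t ht => (hpd t ht).deriv
  have hderiv : ∀ t ∈ Ioo (0 : ℝ) 1, deriv u t = 2 * T * p t / D (u t) :=
    fun t ht => (hud t ht).deriv
  have huC1 : ContDiffOn ℝ 1 u (Ioo 0 1) := by
    rw [show (1 : WithTop ℕ∞) = 0 + 1 from rfl, contDiffOn_succ_iff_deriv_of_isOpen isOpen_Ioo]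
    refine ⟨fun t ht => (hud t ht).differentiableAt.differentiableWithinAt, by simp, ?_⟩
    rw [contDiffOn_zero]
    refine ContinuousOn.congr ?_ hderiv
    exact (continuous_const.mul hpc).continuousOn.div (h.contDiff.continuous.comp huc).continuousOn
      fun t ht => (h.D_pos _ (hupos t ht)).ne'
  have huC2 : ContDiffOn ℝ 2 u (Ioo 0 1) := by
    rw [show (2 : WithTop ℕ∞) = 1 + 1 from by norm_num,
      contDiffOn_succ_iff_deriv_of_isOpen isOpen_Ioo]
    refine ⟨fun t ht => (hud t ht).differentiableAt.differentiableWithinAt, by simp, ?_⟩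
    refine ContDiffOn.congr ?_ hderiv
    exact (contDiffOn_const.mul hpC).div (h.contDiff.comp_contDiffOn huC1)
      fun t ht => (h.D_pos _ (hupos t ht)).ne'
  have hinj := h.strictMonoOn_potential.injOn
  have hbdry : ∀ q, q ^ 2 = potential D g α → V q = 0 := by
    intro q hq
    obtain ⟨h1, h2⟩ := hV q hq.le
    exact hinj (mem_Ici.2 h1.1) (mem_Ici.2 le_rfl) (by rw [h2, hq, sub_self, potential_zero])
  refine ⟨u, ⟨by positivity, huc.continuousOn, huC2, ?_, hupos, ?_, ?_⟩, ?_, ?_⟩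
  · intro t ht
    have h1 := (hpd t ht).const_mul (2 * T)
    rw [show 2 * T * -(T * g (u t)) = -(2 * T ^ 2 * g (u t)) by ring] at h1
    apply h1.congr_of_eventuallyEq
    filter_upwards [isOpen_Ioo.mem_nhds ht] with s hs
    rw [hderiv s hs]
    have := (h.D_pos _ (hupos s hs)).ne'
    field_simp
  · obtain ⟨h1, h2⟩ := hp 0 ⟨le_rfl, zero_le_one⟩
    have : p 0 = P := hmono.injOn h1 hR (by rw [h2, hτP]; ring)
    change V (p 0) = 0
    rw [this]
    exact hbdry P hP2
  · obtain ⟨h1, h2⟩ := hp 1 ⟨zero_le_one, le_rfl⟩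
    have : p 1 = -P := hmono.injOn h1 hN (by rw [h2, hτN]; ring)
    change V (p 1) = 0
    rw [this]
    exact hbdry (-P) (by rw [neg_sq, hP2])
  · rintro _ ⟨t, ht, rfl⟩
    obtain ⟨h1, -⟩ := hV (p t) (hp2 t ht)
    change |V (p t)| ≤ α
    rw [abs_of_nonneg h1.1]
    exact h1.2
  · intro b hb
    have hhalf : (1 / 2 : ℝ) ∈ Icc (0 : ℝ) 1 := by constructor <;> norm_num
    obtain ⟨h1, h2⟩ := hp (1 / 2) hhalf
    have h0 : p (1 / 2) = 0 := hmono.injOn h1 ⟨by linarith, hPpos.le⟩ (by rw [h2, hτ0]; ring)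
    have h3 : u (1 / 2) = α := by
      obtain ⟨h4, h5⟩ := hV 0 (by simpa using (h.potential_pos hα).le)
      change V (p (1 / 2)) = α
      rw [h0]
      exact hinj (mem_Ici.2 h4.1) (mem_Ici.2 hα.le) (by rw [h5]; ring)
    have := hb ⟨1 / 2, hhalf, rfl⟩
    change |u (1 / 2)| ≤ b at this
    rwa [h3, abs_of_pos hα] at this

/-- The bifurcation curve is `2 T(α)²`, as soon as the integral defining `T` converges. -/
theorem IsAdmissible.isBifurcationCurve (h : IsAdmissible D g)
    (hint : ∀ α, 0 < α →
      IntervalIntegrable (fun v => D v / √(potential D g α - potential D g v)) volume 0 α) :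
    IsBifurcationCurve D g fun α => 2 * timeMap D g α ^ 2 := by
  intro α hα μ
  constructor
  · rintro ⟨u, hu, hs⟩
    exact h.param_eq_of_isSolutionPair hα (hint α hα) hu hs
  · rintro rfl
    exact h.exists_isSolutionPair hα (hint α hα)

end BifurcationCurve

/-! ### A Fresnel integral -/

section Fresnel

open Complex

theorem norm_one_sub_cexp_neg_mul_sq_le {z : ℂ} (hz : 0 ≤ z.re) (x : ℝ) :
    ‖1 - cexp (-z * (x : ℂ) ^ 2)‖ ≤ 2 ∧ ‖1 - cexp (-z * (x : ℂ) ^ 2)‖ ≤ 2 * ‖z‖ * x ^ 2 := by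
  have hnorm : ‖-z * (x : ℂ) ^ 2‖ = ‖z‖ * x ^ 2 := by
    rw [norm_mul, norm_neg, norm_pow, norm_real, Real.norm_eq_abs, sq_abs]
  have h2 : ‖1 - cexp (-z * (x : ℂ) ^ 2)‖ ≤ 2 := by
    have hre : (-z * (x : ℂ) ^ 2).re ≤ 0 := by
      rw [← ofReal_pow, re_mul_ofReal, neg_re]
      nlinarith [mul_nonneg hz (sq_nonneg x)]
    calc ‖1 - cexp (-z * (x : ℂ) ^ 2)‖ ≤ ‖(1 : ℂ)‖ + ‖cexp (-z * (x : ℂ) ^ 2)‖ := norm_sub_le _ _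
      _ ≤ 1 + 1 := by
        rw [norm_one, norm_exp]
        gcongr
        exact Real.exp_le_one_iff.2 hre
      _ = 2 := by norm_num
  refine ⟨h2, ?_⟩
  rcases le_total ‖-z * (x : ℂ) ^ 2‖ 1 with h | h
  · rw [norm_sub_rev, mul_assoc, ← hnorm]
    exact norm_exp_sub_one_le h
  · rw [mul_assoc, ← hnorm]
    linarith

theorem norm_fresnel_le {z : ℂ} (hz : 0 ≤ z.re) (hz2 : ‖z‖ ≤ 2) {x : ℝ} (hx : 0 < x) :
    ‖(1 - cexp (-z * (x : ℂ) ^ 2)) / (x : ℂ) ^ 2‖ ≤ 6 * (1 + x ^ 2)⁻¹ := by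
  obtain ⟨h1, h2⟩ := norm_one_sub_cexp_neg_mul_sq_le hz x
  rw [norm_div, norm_pow, norm_real, Real.norm_eq_abs, sq_abs, ← div_eq_mul_inv,
    div_le_div_iff₀ (by positivity) (by positivity)]
  nlinarith [sq_nonneg x]

theorem measurable_fresnel (z : ℂ) :
    Measurable fun x : ℝ => (1 - cexp (-z * (x : ℂ) ^ 2)) / (x : ℂ) ^ 2 := by
  fun_prop

theorem integrableOn_inv_one_add_sq_const_mul (c : ℝ) :
    IntegrableOn (fun x : ℝ => c * (1 + x ^ 2)⁻¹) (Ioi 0) :=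
  (integrable_inv_one_add_sq.const_mul c).integrableOn

theorem integrableOn_fresnel {z : ℂ} (hz : 0 ≤ z.re) (hz2 : ‖z‖ ≤ 2) :
    IntegrableOn (fun x : ℝ => (1 - cexp (-z * (x : ℂ) ^ 2)) / (x : ℂ) ^ 2) (Ioi 0) :=
  (integrableOn_inv_one_add_sq_const_mul 6).mono'
    (measurable_fresnel z).aestronglyMeasurable
    (ae_restrict_of_forall_mem measurableSet_Ioi fun _ hx => norm_fresnel_le hz hz2 hx)

/-- Integration by parts reduces the integral to a Gaussian one. -/
theorem integral_fresnel_of_re_pos {z : ℂ} (hz : 0 < z.re) (hz2 : ‖z‖ ≤ 2) :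
    ∫ x in Ioi (0 : ℝ), (1 - cexp (-z * (x : ℂ) ^ 2)) / (x : ℂ) ^ 2
      = z * (Real.pi / z) ^ (1 / 2 : ℂ) := by
  set F : ℝ → ℂ := fun x => -((1 - cexp (-z * (x : ℂ) ^ 2)) / (x : ℂ)) with hF
  have hint := integrableOn_fresnel hz.le hz2
  have hgauss : IntegrableOn (fun x : ℝ => 2 * z * cexp (-z * (x : ℂ) ^ 2)) (Ioi 0) :=
    ((integrable_cexp_neg_mul_sq hz).const_mul _).integrableOn
  have hFderiv : ∀ x ∈ Ioi (0 : ℝ), HasDerivAt F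
      ((1 - cexp (-z * (x : ℂ) ^ 2)) / (x : ℂ) ^ 2 - 2 * z * cexp (-z * (x : ℂ) ^ 2)) x := by
    intro x hx
    have hx0 : (x : ℂ) ≠ 0 := ofReal_ne_zero.2 (ne_of_gt hx)
    have h1 : HasDerivAt (fun w : ℂ => -((1 - cexp (-z * w ^ 2)) / w))
        ((1 - cexp (-z * (x : ℂ) ^ 2)) / (x : ℂ) ^ 2 - 2 * z * cexp (-z * (x : ℂ) ^ 2)) (x : ℂ) := by
      have h2 := (((hasDerivAt_pow 2 (x : ℂ)).const_mul (-z)).cexp.const_sub 1).div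
        (hasDerivAt_id (x : ℂ)) hx0
      convert! h2.neg using 1
      simp only [id]
      field_simp
      push_cast
      ring
    exact h1.comp_ofReal
  have hFbound : ∀ x : ℝ, ‖F x‖ ≤ 2 * ‖z‖ * |x| := by
    intro x
    rcases eq_or_ne x 0 with rfl | hx
    · simp [hF]
    · have hx' : 0 < |x| := abs_pos.2 hx
      rw [hF, norm_neg, norm_div, norm_real, Real.norm_eq_abs, div_le_iff₀ hx', mul_assoc,
        abs_mul_abs_self, ← sq]
      exact (norm_one_sub_cexp_neg_mul_sq_le hz.le x).2
  have hF0 : F 0 = 0 := by simp [hF]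
  have hcont : ContinuousWithinAt F (Ici 0) 0 := by
    apply ContinuousAt.continuousWithinAt
    rw [ContinuousAt, hF0]
    apply squeeze_zero_norm hFbound
    have : Continuous fun x : ℝ => 2 * ‖z‖ * |x| := by fun_prop
    simpa using this.tendsto 0
  have hlim : Tendsto F atTop (𝓝 0) := by
    have h2 : Tendsto (fun x : ℝ => 2 * x⁻¹) atTop (𝓝 0) := by
      simpa using (tendsto_inv_atTop_zero (𝕜 := ℝ)).const_mul 2
    refine squeeze_zero_norm' ?_ h2
    filter_upwards [eventually_gt_atTop 0] with x hx
    rw [hF, norm_neg, norm_div, norm_real, Real.norm_eq_abs, abs_of_pos hx, div_eq_mul_inv]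
    gcongr
    exact (norm_one_sub_cexp_neg_mul_sq_le hz.le x).1
  have := integral_Ioi_of_hasDerivAt_of_tendsto hcont hFderiv (hint.sub hgauss) hlim
  rw [integral_sub hint hgauss, hF0, sub_zero, sub_eq_zero, integral_const_mul,
    integral_gaussian_complex_Ioi hz] at this
  rw [this]
  ring

/-- The value at the boundary point `z = i` is the limit of the values in the right half plane. -/
theorem integral_fresnel_I :
    ∫ x in Ioi (0 : ℝ), (1 - cexp (-I * (x : ℂ) ^ 2)) / (x : ℂ) ^ 2
      = √(Real.pi / 2) * (1 + I) := by
  have hl : Tendsto (fun ε : ℝ => (ε : ℂ) + I) (𝓝[>] 0) (𝓝 I) := by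
    have : Continuous fun ε : ℝ => (ε : ℂ) + I := by fun_prop
    simpa using (this.tendsto 0).mono_left (nhdsWithin_le_nhds (s := Ioi 0))
  have hnorm : ∀ᶠ ε : ℝ in 𝓝[>] 0, 0 < ((ε : ℂ) + I).re ∧ ‖(ε : ℂ) + I‖ ≤ 2 := by
    filter_upwards [Ioo_mem_nhdsGT (zero_lt_one' ℝ)] with ε hε
    refine ⟨by simpa using hε.1, (norm_add_le _ _).trans ?_⟩
    rw [norm_real, Real.norm_eq_abs, abs_of_pos hε.1, norm_I]
    linarith [hε.2]
  have h1 : Tendsto (fun ε : ℝ =>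
        ∫ x in Ioi (0 : ℝ), (1 - cexp (-((ε : ℂ) + I) * (x : ℂ) ^ 2)) / (x : ℂ) ^ 2) (𝓝[>] 0)
      (𝓝 (∫ x in Ioi (0 : ℝ), (1 - cexp (-I * (x : ℂ) ^ 2)) / (x : ℂ) ^ 2)) := by
    apply tendsto_integral_filter_of_dominated_convergence _ _ _
      (integrableOn_inv_one_add_sq_const_mul 6)
    · refine ae_of_all _ fun x => ?_
      have : Continuous fun z : ℂ => (1 - cexp (-z * (x : ℂ) ^ 2)) / (x : ℂ) ^ 2 := by fun_prop
      exact (this.tendsto I).comp hl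
    · exact Eventually.of_forall fun ε => (measurable_fresnel _).aestronglyMeasurable
    · filter_upwards [hnorm] with ε hε
      exact ae_restrict_of_forall_mem measurableSet_Ioi fun _ hx =>
        norm_fresnel_le hε.1.le hε.2 hx
  have h2 : Tendsto (fun ε : ℝ => ((ε : ℂ) + I) * (Real.pi / ((ε : ℂ) + I)) ^ (1 / 2 : ℂ)) (𝓝[>] 0)
      (𝓝 (I * (Real.pi / I) ^ (1 / 2 : ℂ))) := by
    apply hl.mul
    refine (tendsto_const_nhds.div hl I_ne_zero).cpow tendsto_const_nhds ?_
    rw [div_I]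
    right
    simp [Real.pi_ne_zero]
  have h3 : (fun ε : ℝ =>
        ∫ x in Ioi (0 : ℝ), (1 - cexp (-((ε : ℂ) + I) * (x : ℂ) ^ 2)) / (x : ℂ) ^ 2) =ᶠ[𝓝[>] 0]
      fun ε : ℝ => ((ε : ℂ) + I) * (Real.pi / ((ε : ℂ) + I)) ^ (1 / 2 : ℂ) := by
    filter_upwards [hnorm] with ε hε
    exact integral_fresnel_of_re_pos hε.1 hε.2
  rw [tendsto_nhds_unique (h1.congr' h3) h2]
  have h4 : ((Real.pi : ℂ) / I) ^ (1 / 2 : ℂ) = √Real.pi * cexp (-(Real.pi / 4 : ℝ) * I) := by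
    have hne : (Real.pi : ℂ) * -I ≠ 0 := by simp [Real.pi_ne_zero]
    rw [div_I, ← mul_neg, cpow_def_of_ne_zero hne, log_ofReal_mul Real.pi_pos (by simp),
      log_neg_I, Real.sqrt_eq_rpow, Real.rpow_def_of_pos Real.pi_pos, ofReal_exp, ← exp_add]
    congr 1
    push_cast
    ring
  have h5 : cexp (-(Real.pi / 4 : ℝ) * I) = (√2 / 2 : ℝ) - (√2 / 2 : ℝ) * I := by
    rw [← ofReal_neg, exp_mul_I, ← ofReal_cos, ← ofReal_sin, Real.cos_neg, Real.sin_neg,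
      Real.cos_pi_div_four, Real.sin_pi_div_four]
    push_cast
    ring
  have h6 : √(Real.pi / 2) = √Real.pi * (√2 / 2) := by
    rw [Real.sqrt_div Real.pi_pos.le, div_eq_mul_inv]
    congr 1
    rw [inv_eq_one_div, div_eq_div_iff (by positivity) (by positivity), one_mul,
      Real.mul_self_sqrt (by norm_num)]
  rw [h4, h5, h6]
  push_cast
  linear_combination (-√Real.pi * (√2 / 2) : ℂ) * I_mul_I

/-- The integrand of `integral_fresnel_I` in terms of its real and imaginary parts. -/
theorem fresnel_eq (x : ℝ) : (1 - cexp (-I * (x : ℂ) ^ 2)) / (x : ℂ) ^ 2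
    = ((1 - Real.cos (x ^ 2)) / x ^ 2 : ℝ) + (Real.sin (x ^ 2) / x ^ 2 : ℝ) * I := by
  have : -I * (x : ℂ) ^ 2 = ((-x ^ 2 : ℝ) : ℂ) * I := by push_cast; ring
  rw [this, exp_mul_I, ← ofReal_cos, ← ofReal_sin, Real.cos_neg, Real.sin_neg]
  push_cast
  ring

theorem integral_one_sub_cos_sq_div_sq :
    ∫ x in Ioi (0 : ℝ), (1 - Real.cos (x ^ 2)) / x ^ 2 = √(Real.pi / 2) := by
  have := reCLM.integral_comp_comm (integrableOn_fresnel (z := I) (by simp) (by simp))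
  rw [integral_fresnel_I] at this
  simp_rw [fresnel_eq] at this
  simpa [-ofReal_div, -ofReal_sub] using this

theorem integral_sin_sq_div_sq :
    ∫ x in Ioi (0 : ℝ), Real.sin (x ^ 2) / x ^ 2 = √(Real.pi / 2) := by
  have := imCLM.integral_comp_comm (integrableOn_fresnel (z := I) (by simp) (by simp))
  rw [integral_fresnel_I] at this
  simp_rw [fresnel_eq] at this
  simpa [-ofReal_div, -ofReal_sub] using this

/-- A dominating function for the real and imaginary parts. -/
theorem abs_fresnel_le {x : ℝ} (hx : 0 < x) :
    |(1 - Real.cos (x ^ 2)) / x ^ 2| ≤ 6 * (1 + x ^ 2)⁻¹ ∧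
      |Real.sin (x ^ 2) / x ^ 2| ≤ 6 * (1 + x ^ 2)⁻¹ := by
  have h := norm_fresnel_le (z := I) (by simp) (by simp) hx
  rw [fresnel_eq] at h
  constructor
  · refine le_trans ?_ ((abs_re_le_norm _).trans h)
    simp [-ofReal_div, -ofReal_sub]
  · refine le_trans ?_ ((abs_im_le_norm _).trans h)
    simp [-ofReal_div, -ofReal_sub]

end Fresnel

/-! ### Integrands with an inverse square root singularity -/

section InverseSqrt

theorem intervalIntegrable_inv_sqrt_sub {a : ℝ} (ha : 0 ≤ a) :
    IntervalIntegrable (fun s => (√(a - s))⁻¹) volume 0 a := by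
  have h : IntervalIntegrable (fun x : ℝ => x ^ (-(1 / 2) : ℝ)) volume 0 a :=
    intervalIntegral.intervalIntegrable_rpow' (by norm_num)
  have h2 := (h.comp_sub_left a).symm
  rw [sub_zero, sub_self] at h2
  refine h2.congr_uIoo fun s hs => ?_
  change (a - s) ^ (-(1 / 2) : ℝ) = (√(a - s))⁻¹
  rw [Real.sqrt_eq_rpow]
  rw [uIoo_of_le ha] at hs
  rw [Real.rpow_neg (by linarith [hs.2])]

theorem intervalIntegrable_of_abs_le_inv_sqrt {a K : ℝ} (ha : 0 ≤ a) {f : ℝ → ℝ}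
    (hm : Measurable f) (hf : ∀ s ∈ Ioo 0 a, |f s| ≤ K * (√(a - s))⁻¹) :
    IntervalIntegrable f volume 0 a := by
  have h := (intervalIntegrable_iff_integrableOn_Ioo_of_le ha).1
    ((intervalIntegrable_inv_sqrt_sub ha).const_mul K)
  rw [intervalIntegrable_iff_integrableOn_Ioo_of_le ha]
  exact h.mono' hm.aestronglyMeasurable (ae_restrict_of_forall_mem measurableSet_Ioo hf)

theorem abs_integral_sub_integral_le {K : ℝ} {f h : ℝ → ℝ}
    (hf : IntervalIntegrable f volume 0 1) (hh : IntervalIntegrable h volume 0 1)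
    (hfh : ∀ s ∈ Ioo (0 : ℝ) 1, |f s - h s| ≤ K * (√(1 - s))⁻¹) :
    |(∫ s in (0 : ℝ)..1, f s) - ∫ s in (0 : ℝ)..1, h s|
      ≤ K * ∫ s in (0 : ℝ)..1, (√(1 - s))⁻¹ := by
  rw [← intervalIntegral.integral_sub hf hh, ← intervalIntegral.integral_const_mul,
    ← Real.norm_eq_abs]
  apply intervalIntegral.norm_integral_le_of_norm_le zero_le_one
  · filter_upwards [Measure.ae_ne volume (1 : ℝ)] with s hs1 hs
    exact hfh s ⟨hs.1, lt_of_le_of_ne hs.2 hs1⟩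
  · exact (intervalIntegrable_inv_sqrt_sub zero_le_one).const_mul K

theorem inv_sqrt_le_inv_sqrt_one_sub {s y : ℝ} (hs : s < 1) (hy : 1 - s ≤ y) :
    (√y)⁻¹ ≤ (√(1 - s))⁻¹ :=
  inv_anti₀ (Real.sqrt_pos.2 (by linarith)) (Real.sqrt_le_sqrt hy)

theorem one_sub_le_one_sub_pow {s : ℝ} (hs : s ∈ Ioo (0 : ℝ) 1) {n : ℕ} (hn : n ≠ 0) :
    1 - s ≤ 1 - s ^ n := by
  have := pow_le_of_le_one hs.1.le hs.2.le hn
  linarith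

theorem abs_inv_sqrt_one_add_sub_le {ρ : ℝ} (hρ : |ρ| ≤ 1 / 2) :
    |(√(1 + ρ))⁻¹ - (1 - ρ / 2)| ≤ ρ ^ 2 := by
  obtain ⟨h1, h2⟩ := abs_le.1 hρ
  have hx : 0 < √(1 + ρ) := Real.sqrt_pos.2 (by linarith)
  have hsq : √(1 + ρ) ^ 2 = 1 + ρ := Real.sq_sqrt (by linarith)
  set x := √(1 + ρ) with hxdef
  have hρx : ρ = x ^ 2 - 1 := by linarith
  have hxl : 1 / 2 ≤ x := by nlinarith
  have key : x⁻¹ - (1 - ρ / 2) = (x - 1) ^ 2 * (x + 2) / (2 * x) := by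
    rw [hρx]
    field_simp
    ring
  rw [key, abs_of_nonneg (by positivity), div_le_iff₀ (by positivity), hρx]
  have : (x ^ 2 - 1) ^ 2 * (2 * x) - (x - 1) ^ 2 * (x + 2)
      = (x - 1) ^ 2 * (2 * x * (x + 1) ^ 2 - (x + 2)) := by ring
  have h3 : 0 ≤ 2 * x * (x + 1) ^ 2 - (x + 2) := by nlinarith [sq_nonneg (x - 1 / 2)]
  nlinarith [mul_nonneg (sq_nonneg (x - 1)) h3]

/-- Expansion of `(n + d) / √(1 + m + e)` to first order in `m`, with `d` and `e` as errors. -/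
theorem abs_mul_inv_sqrt_sub_le {n d m e : ℝ} (hρ : |m + e| ≤ 1 / 2) :
    |(n + d) * (√(1 + (m + e)))⁻¹ - (n - n * m / 2)|
      ≤ |n| * (|e| / 2 + (m + e) ^ 2) + 2 * |d| := by
  have h := abs_inv_sqrt_one_add_sub_le hρ
  set η := (√(1 + (m + e)))⁻¹ - (1 - (m + e) / 2) with hη
  have h1 : (√(1 + (m + e)))⁻¹ = 1 - (m + e) / 2 + η := by rw [hη]; ring
  have h2 : |1 - (m + e) / 2 + η| ≤ 2 := by
    obtain ⟨h3, h4⟩ := abs_le.1 hρ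
    obtain ⟨h5, h6⟩ := abs_le.1 h
    rw [abs_le]
    constructor <;> nlinarith
  rw [h1, show (n + d) * (1 - (m + e) / 2 + η) - (n - n * m / 2)
    = n * (-(e / 2) + η) + d * (1 - (m + e) / 2 + η) by ring]
  refine (abs_add_le _ _).trans ?_
  rw [abs_mul, abs_mul, mul_comm 2 |d|]
  gcongr
  refine (abs_add_le _ _).trans ?_
  rw [abs_neg, abs_div, abs_two]
  gcongr

end InverseSqrt

/-! ### The potential of the oscillating diffusion -/

noncomputable section

/-- The diffusion `u² + sin u`. -/
def oscDiffusion (u : ℝ) : ℝ := u ^ 2 + Real.sin u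

/-- The nonlinearity `u + sin u`. -/
def oscReaction (u : ℝ) : ℝ := u + Real.sin u

/-- The potential of `oscDiffusion` and `oscReaction`. -/
def oscPotential : ℝ → ℝ := potential oscDiffusion oscReaction

end

section Oscillating

theorem cube_le_oscDiffusion_mul_oscReaction {x : ℝ} (hx : 0 ≤ x) :
    0 ≤ oscDiffusion x ∧ 0 ≤ oscReaction x ∧
      x ^ 3 / 4 ≤ oscDiffusion x * oscReaction x := by
  obtain ⟨h1, h2⟩ : x ^ 2 / 2 ≤ oscDiffusion x ∧ x / 2 ≤ oscReaction x := by
    unfold oscDiffusion oscReaction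
    rcases le_total x Real.pi with h | h
    · have := Real.sin_nonneg_of_nonneg_of_le_pi hx h
      constructor <;> nlinarith
    · have := Real.neg_one_le_sin x
      have := Real.pi_gt_three
      constructor <;> nlinarith
  refine ⟨by nlinarith, by linarith, ?_⟩
  calc x ^ 3 / 4 = x ^ 2 / 2 * (x / 2) := by ring
    _ ≤ _ := mul_le_mul h1 h2 (by linarith) (by nlinarith)

theorem isAdmissible_osc : IsAdmissible oscDiffusion oscReaction where
  contDiff := by unfold oscDiffusion; fun_prop
  continuous := by unfold oscReaction; fun_prop
  D_pos x hx := by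
    obtain ⟨h1, h2, h3⟩ := cube_le_oscDiffusion_mul_oscReaction hx.le
    have : 0 < x ^ 3 / 4 := by positivity
    exact h1.lt_of_ne fun h => by rw [← h] at h3; linarith
  g_pos x hx := by
    obtain ⟨h1, h2, h3⟩ := cube_le_oscDiffusion_mul_oscReaction hx.le
    have : 0 < x ^ 3 / 4 := by positivity
    exact h2.lt_of_ne fun h => by rw [← h] at h3; linarith

theorem hasDerivAt_oscPotential (x : ℝ) :
    HasDerivAt oscPotential (oscDiffusion x * oscReaction x) x :=
  isAdmissible_osc.hasDerivAt_potential x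

theorem measurable_oscIntegrand (α : ℝ) :
    Measurable fun v => oscDiffusion v / √(oscPotential α - oscPotential v) := by
  have h1 : Continuous oscPotential := isAdmissible_osc.continuous_potential
  have h2 : Continuous oscDiffusion := isAdmissible_osc.contDiff.continuous
  exact h2.measurable.div (continuous_const.sub h1).sqrt.measurable

theorem le_oscPotential_sub {α v : ℝ} (hv : 0 ≤ v) (hvα : v ≤ α) :
    (α ^ 4 - v ^ 4) / 16 ≤ oscPotential α - oscPotential v := by
  have hd : ∀ x, HasDerivAt (fun x => oscPotential x - x ^ 4 / 16)
      (oscDiffusion x * oscReaction x - x ^ 3 / 4) x := by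
    intro x
    have := (hasDerivAt_oscPotential x).sub ((hasDerivAt_pow 4 x).div_const 16)
    convert! this using 1
    push_cast
    ring
  have hmono : MonotoneOn (fun x => oscPotential x - x ^ 4 / 16) (Ici 0) := by
    apply monotoneOn_of_deriv_nonneg (convex_Ici 0)
      fun x _ => (hd x).continuousAt.continuousWithinAt
    · exact fun x _ => (hd x).differentiableAt.differentiableWithinAt
    · intro x hx
      rw [interior_Ici] at hx
      rw [(hd x).deriv]
      linarith [(cube_le_oscDiffusion_mul_oscReaction (le_of_lt hx)).2.2]
  have := hmono (mem_Ici.2 hv) (mem_Ici.2 (hv.trans hvα)) hvα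
  simp only at this
  linarith

theorem abs_oscDiffusion_le {α v : ℝ} (hv : 0 ≤ v) (hvα : v ≤ α) :
    |oscDiffusion v| ≤ α ^ 2 + 1 := by
  have h1 := Real.neg_one_le_sin v
  have h2 := Real.sin_le_one v
  unfold oscDiffusion
  rw [abs_le]
  constructor <;> nlinarith

theorem intervalIntegrable_oscIntegrand {α : ℝ} (hα : 0 < α) :
    IntervalIntegrable (fun v => oscDiffusion v / √(oscPotential α - oscPotential v))
      volume 0 α := by
  refine intervalIntegrable_of_abs_le_inv_sqrt (K := (α ^ 2 + 1) * (√(α ^ 3 / 16))⁻¹) hα.le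
    (measurable_oscIntegrand α) fun v hv => ?_
  have h : α ^ 3 / 16 * (α - v) ≤ oscPotential α - oscPotential v := by
    refine le_trans ?_ (le_oscPotential_sub hv.1.le hv.2.le)
    have : v ^ 3 ≤ α ^ 3 := pow_le_pow_left₀ hv.1.le hv.2.le 3
    nlinarith [hv.1]
  have hpos : 0 < α ^ 3 / 16 * (α - v) := mul_pos (by positivity) (by linarith [hv.2])
  rw [abs_div, abs_of_nonneg (Real.sqrt_nonneg _), div_eq_mul_inv, mul_assoc, ← mul_inv,
    ← Real.sqrt_mul (by positivity)]
  gcongr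
  exact abs_oscDiffusion_le hv.1.le hv.2.le

theorem timeMap_osc_eq (α : ℝ) :
    timeMap oscDiffusion oscReaction α
      = α * ∫ s in (0 : ℝ)..1, oscDiffusion (α * s) / √(oscPotential α - oscPotential (α * s)) := by
  have := intervalIntegral.smul_integral_comp_mul_left (a := 0) (b := 1)
    (fun v => oscDiffusion v / √(oscPotential α - oscPotential v)) α
  rw [mul_zero, mul_one, smul_eq_mul] at this
  exact this.symm

end Oscillating

/-! ### Small amplitudes -/

section Small

/-- Near `0` the product `D g` is `2 x² + 2 x³ + O(x⁴)`. -/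
theorem abs_oscDiffusion_mul_sub_le {x : ℝ} (hx : 0 ≤ x) (hx1 : x ≤ 1) :
    |oscDiffusion x * oscReaction x - (2 * x ^ 2 + 2 * x ^ 3)| ≤ 2 * x ^ 4 := by
  obtain ⟨δ, hδ, h0, h1⟩ : ∃ δ, Real.sin x = x - δ ∧ 0 ≤ δ ∧ δ ≤ x ^ 3 / 4 := by
    refine ⟨x - Real.sin x, by ring, by linarith [Real.sin_le hx], ?_⟩
    rcases hx.eq_or_lt with rfl | h
    · simp
    · linarith [Real.sin_gt_sub_cube h, pow_pos h 3]
  unfold oscDiffusion oscReaction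
  rw [hδ, show (x ^ 2 + (x - δ)) * (x + (x - δ)) - (2 * x ^ 2 + 2 * x ^ 3)
    = δ ^ 2 - δ * (x ^ 2 + 3 * x) by ring]
  have h2 : δ * (x ^ 2 + 3 * x) ≤ x ^ 3 / 4 * (4 * x) := by
    apply mul_le_mul h1 (by nlinarith) (by positivity) (by positivity)
  have h3 : δ ^ 2 ≤ (x ^ 3 / 4) ^ 2 := pow_le_pow_left₀ h0 h1 2
  have h4 : x ^ 6 ≤ x ^ 4 := pow_le_pow_of_le_one hx hx1 (by norm_num)
  have h5 : 0 ≤ δ * (x ^ 2 + 3 * x) := by positivity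
  rw [abs_le]
  constructor <;> nlinarith

theorem abs_oscPotential_sub_le {α v : ℝ} (hv : 0 ≤ v) (hvα : v ≤ α) (hα : α ≤ 1) :
    |oscPotential α - oscPotential v
      - (2 / 3 * (α ^ 3 - v ^ 3) + 1 / 2 * (α ^ 4 - v ^ 4))| ≤ 2 * α ^ 4 * (α - v) := by
  have hd : ∀ x ∈ Icc v α,
      HasDerivWithinAt (fun x => oscPotential x - (2 / 3 * x ^ 3 + 1 / 2 * x ^ 4))
      (oscDiffusion x * oscReaction x - (2 * x ^ 2 + 2 * x ^ 3)) (Icc v α) x := by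
    intro x _
    have := (hasDerivAt_oscPotential x).sub
      (((hasDerivAt_pow 3 x).const_mul (2 / 3)).add ((hasDerivAt_pow 4 x).const_mul (1 / 2)))
    apply HasDerivAt.hasDerivWithinAt
    convert! this using 1
    push_cast
    ring
  have := (convex_Icc v α).norm_image_sub_le_of_norm_hasDerivWithin_le (C := 2 * α ^ 4) hd
    (fun x hx => by
      refine (abs_oscDiffusion_mul_sub_le (hv.trans hx.1) (hx.2.trans hα)).trans ?_
      have := pow_le_pow_left₀ (hv.trans hx.1) hx.2 4
      linarith) (left_mem_Icc.2 hvα) (right_mem_Icc.2 hvα)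
  rw [Real.norm_eq_abs, Real.norm_eq_abs, abs_of_nonneg (sub_nonneg.2 hvα)] at this
  convert! this using 2
  ring

theorem quotient_bounds {s : ℝ} (hs : s ∈ Ioo (0 : ℝ) 1) :
    0 ≤ (1 - s ^ 4) / (1 - s ^ 3) ∧ (1 - s ^ 4) / (1 - s ^ 3) ≤ 4 / 3 := by
  obtain ⟨h0, h1⟩ := hs
  have h3 : 0 < 1 - s ^ 3 := by linarith [one_sub_le_one_sub_pow ⟨h0, h1⟩ three_ne_zero]
  have h4 : 0 < 1 - s ^ 4 := by linarith [one_sub_le_one_sub_pow ⟨h0, h1⟩ four_ne_zero]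
  refine ⟨by positivity, ?_⟩
  rw [div_le_iff₀ h3]
  have : 4 / 3 * (1 - s ^ 3) - (1 - s ^ 4) = (1 - s) ^ 2 * (1 / 3 + 2 / 3 * s + s ^ 2) := by ring
  nlinarith [mul_nonneg (sq_nonneg (1 - s)) (by positivity : 0 ≤ 1 / 3 + 2 / 3 * s + s ^ 2)]

/-- The integrand of the time map, divided by `√(3α/2)`, to first order in `α`. -/
theorem abs_small_integrand_sub_le {α s : ℝ} (hα : 0 < α) (hα8 : α ≤ 1 / 8)
    (hs : s ∈ Ioo (0 : ℝ) 1) :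
    |α * (oscDiffusion (α * s) / √(oscPotential α - oscPotential (α * s))) / √(3 / 2 * α)
      - (s / √(1 - s ^ 3)
        + α * (1 / √(1 - s ^ 3) * (s ^ 2 - 3 * s * (1 - s ^ 4) / (8 * (1 - s ^ 3)))))|
      ≤ 50 * α ^ 2 * (√(1 - s))⁻¹ := by
  obtain ⟨h0, h1⟩ := hs
  have hs2 : s ^ 2 ≤ 1 := pow_le_one₀ h0.le h1.le
  have hαs : α * s ≤ α := mul_le_of_le_one_right hα.le h1.le
  have hw3 : 1 - s ≤ 1 - s ^ 3 := one_sub_le_one_sub_pow ⟨h0, h1⟩ three_ne_zero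
  have h3 : 0 < 1 - s ^ 3 := by linarith
  obtain ⟨ha0, ha⟩ := quotient_bounds ⟨h0, h1⟩
  set a := (1 - s ^ 4) / (1 - s ^ 3) with ha_def
  have hs4 : 1 - s ^ 4 = a * (1 - s ^ 3) := by rw [ha_def]; field_simp
  -- The relative error in the potential.
  set E := oscPotential α - oscPotential (α * s)
      - (2 / 3 * (α ^ 3 - (α * s) ^ 3) + 1 / 2 * (α ^ 4 - (α * s) ^ 4)) with hE
  have hEle : |E| ≤ 2 * α ^ 4 * (α - α * s) :=
    abs_oscPotential_sub_le (by positivity) hαs (by linarith)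
  set e := E / (2 / 3 * α ^ 3 * (1 - s ^ 3)) with he
  set m := 3 / 4 * α * a with hm
  have hele : |e| ≤ 3 * α ^ 2 := by
    rw [he, abs_div, abs_of_pos (by positivity : 0 < 2 / 3 * α ^ 3 * (1 - s ^ 3)),
      div_le_iff₀ (by positivity)]
    refine hEle.trans ?_
    have : 2 * α ^ 5 * (1 - s) ≤ 2 * α ^ 5 * (1 - s ^ 3) := by gcongr
    linarith
  have hpot : oscPotential α - oscPotential (α * s)
      = 2 / 3 * α ^ 3 * ((1 - s ^ 3) * (1 + (m + e))) := by
    have hEe : E = e * (2 / 3 * α ^ 3 * (1 - s ^ 3)) := by rw [he]; field_simp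
    have : oscPotential α - oscPotential (α * s)
      = E + (2 / 3 * (α ^ 3 - (α * s) ^ 3) + 1 / 2 * (α ^ 4 - (α * s) ^ 4)) := by rw [hE]; ring
    rw [this, hEe, hm]
    linear_combination (1 / 2 * α ^ 4) * hs4
  have hm0 : 0 ≤ m := by positivity
  have hm1 : m ≤ α := by
    rw [hm]
    have := mul_le_mul_of_nonneg_left ha hα.le
    linarith
  have hme : |m + e| ≤ 2 * α := by
    refine (abs_add_le _ _).trans ?_
    rw [abs_of_nonneg hm0]
    have : α ^ 2 ≤ 1 / 8 * α := by rw [sq]; gcongr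
    linarith
  -- The error in the diffusion.
  set d := (Real.sin (α * s) - α * s) / α with hd
  have hdle : |d| ≤ α ^ 2 := by
    have hx0 : 0 < α * s := by positivity
    have h2 := Real.sin_le hx0.le
    have h4 := Real.sin_gt_sub_cube hx0
    have h5 : (α * s) ^ 3 ≤ α ^ 3 := pow_le_pow_left₀ hx0.le hαs 3
    have h6 : 0 < α ^ 3 := by positivity
    rw [hd, abs_div, abs_of_pos hα, div_le_iff₀ hα, abs_le, show α ^ 2 * α = α ^ 3 by ring]
    constructor <;> linarith
  have hD : oscDiffusion (α * s) = α * ((s + α * s ^ 2) + d) := by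
    unfold oscDiffusion
    rw [hd]
    field_simp
    ring
  have hmain := abs_mul_inv_sqrt_sub_le (n := s + α * s ^ 2) (d := d) (m := m) (e := e)
    (hme.trans (by linarith))
  have hscale : α * (oscDiffusion (α * s) / √(oscPotential α - oscPotential (α * s)))
      / √(3 / 2 * α) = ((s + α * s ^ 2) + d) * (√(1 + (m + e)))⁻¹ * (√(1 - s ^ 3))⁻¹ := by
    have h4 : √(3 / 2 * α) * √(2 / 3 * α ^ 3) = α ^ 2 := by
      rw [← Real.sqrt_mul (by positivity), show 3 / 2 * α * (2 / 3 * α ^ 3) = (α ^ 2) ^ 2 by ring,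
        Real.sqrt_sq (by positivity)]
    rw [hpot, hD, Real.sqrt_mul (by positivity), Real.sqrt_mul h3.le]
    have h5 : 0 < √(3 / 2 * α) := Real.sqrt_pos.2 (by positivity)
    have h6 : 0 < √(2 / 3 * α ^ 3) := Real.sqrt_pos.2 (by positivity)
    calc _ = α ^ 2 / (√(3 / 2 * α) * √(2 / 3 * α ^ 3)) *
          (((s + α * s ^ 2) + d) * (√(1 + (m + e)))⁻¹ * (√(1 - s ^ 3))⁻¹) := by
          field_simp
      _ = _ := by rw [h4, div_self (by positivity), one_mul]
  have htarget : s / √(1 - s ^ 3)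
        + α * (1 / √(1 - s ^ 3) * (s ^ 2 - 3 * s * (1 - s ^ 4) / (8 * (1 - s ^ 3))))
      = (s + α * s ^ 2 - s * m / 2) * (√(1 - s ^ 3))⁻¹ := by
    have : 3 * s * (1 - s ^ 4) / (8 * (1 - s ^ 3)) = 3 / 8 * s * a := by
      rw [ha_def]; field_simp
    rw [this, hm]
    ring
  rw [hscale, htarget, ← sub_mul, abs_mul, abs_of_nonneg (inv_nonneg.2 (Real.sqrt_nonneg _))]
  refine mul_le_mul ?_ (inv_sqrt_le_inv_sqrt_one_sub h1 hw3) (by positivity) (by positivity)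
  have hsplit : ((s + α * s ^ 2) + d) * (√(1 + (m + e)))⁻¹ - (s + α * s ^ 2 - s * m / 2)
      = (((s + α * s ^ 2) + d) * (√(1 + (m + e)))⁻¹
        - ((s + α * s ^ 2) - (s + α * s ^ 2) * m / 2)) + -(α * s ^ 2 * m / 2) := by ring
  rw [hsplit]
  refine (abs_add_le _ _).trans ?_
  have hn : |s + α * s ^ 2| ≤ 2 := by
    rw [abs_of_nonneg (by positivity)]
    have : α * s ^ 2 ≤ 1 * 1 := mul_le_mul (by linarith) hs2 (by positivity) zero_le_one
    linarith
  have hme2 : (m + e) ^ 2 ≤ 4 * α ^ 2 := by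
    rw [← sq_abs]
    calc |m + e| ^ 2 ≤ (2 * α) ^ 2 := pow_le_pow_left₀ (abs_nonneg _) hme 2
      _ = 4 * α ^ 2 := by ring
  have hlast : |-(α * s ^ 2 * m / 2)| ≤ α ^ 2 := by
    rw [abs_neg, abs_of_nonneg (by positivity)]
    have : s ^ 2 * m ≤ 1 * α := mul_le_mul hs2 hm1 hm0 zero_le_one
    have := mul_le_mul_of_nonneg_left this hα.le
    have := sq_nonneg α
    calc α * s ^ 2 * m / 2 = α * (s ^ 2 * m) / 2 := by ring
      _ ≤ α ^ 2 := by linarith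
  have hprod : |s + α * s ^ 2| * (|e| / 2 + (m + e) ^ 2) ≤ 2 * (3 * α ^ 2 / 2 + 4 * α ^ 2) := by
    gcongr
  have := sq_nonneg α
  linarith

theorem intervalIntegrable_constC₀ :
    IntervalIntegrable (fun s : ℝ => s / √(1 - s ^ 3)) volume 0 1 := by
  refine intervalIntegrable_of_abs_le_inv_sqrt (K := 1) zero_le_one (by fun_prop) fun s hs => ?_
  rw [abs_of_nonneg (div_nonneg hs.1.le (Real.sqrt_nonneg _)), div_eq_mul_inv]
  exact mul_le_mul hs.2.le (inv_sqrt_le_inv_sqrt_one_sub hs.2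
    (one_sub_le_one_sub_pow hs three_ne_zero)) (by positivity) zero_le_one

theorem intervalIntegrable_constC₁ :
    IntervalIntegrable (fun s : ℝ =>
      1 / √(1 - s ^ 3) * (s ^ 2 - 3 * s * (1 - s ^ 4) / (8 * (1 - s ^ 3)))) volume 0 1 := by
  refine intervalIntegrable_of_abs_le_inv_sqrt (K := 1) zero_le_one (by fun_prop) fun s hs => ?_
  obtain ⟨ha0, ha⟩ := quotient_bounds hs
  have h3 : 3 * s * (1 - s ^ 4) / (8 * (1 - s ^ 3))
      = 3 / 8 * s * ((1 - s ^ 4) / (1 - s ^ 3)) := by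
    rw [mul_div_mul_comm]
    ring
  rw [h3, abs_mul, abs_of_nonneg (by positivity : 0 ≤ 1 / √(1 - s ^ 3)), one_div, mul_comm]
  refine mul_le_mul ?_ (inv_sqrt_le_inv_sqrt_one_sub hs.2
    (one_sub_le_one_sub_pow hs three_ne_zero)) (by positivity) zero_le_one
  have h4 : s * ((1 - s ^ 4) / (1 - s ^ 3)) ≤ 1 * (4 / 3) :=
    mul_le_mul hs.2.le ha ha0 zero_le_one
  have h5 : 0 ≤ s * ((1 - s ^ 4) / (1 - s ^ 3)) := mul_nonneg hs.1.le ha0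
  have h6 : s ^ 2 ≤ 1 := by nlinarith [hs.1, hs.2]
  rw [abs_le]
  constructor <;> nlinarith [sq_nonneg s]

theorem intervalIntegrable_scaled_oscIntegrand {α : ℝ} (hα : 0 < α) :
    IntervalIntegrable
      (fun s => oscDiffusion (α * s) / √(oscPotential α - oscPotential (α * s))) volume 0 1 := by
  have := (intervalIntegrable_oscIntegrand hα).comp_mul_left (c := α)
  rwa [zero_div, div_self hα.ne'] at this

/-- The time map for small amplitudes. -/
theorem exists_abs_timeMap_small_sub_le :
    ∃ K, 0 ≤ K ∧ ∀ α, 0 < α → α ≤ 1 / 8 →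
      |timeMap oscDiffusion oscReaction α / √(3 / 2 * α) - (constC₀ + constC₁ * α)|
        ≤ K * α ^ 2 := by
  refine ⟨50 * ∫ s in (0 : ℝ)..1, (√(1 - s))⁻¹, ?_, fun α hα hα8 => ?_⟩
  · apply mul_nonneg (by norm_num)
    exact intervalIntegral.integral_nonneg zero_le_one fun s _ => inv_nonneg.2 (Real.sqrt_nonneg _)
  have hf := ((intervalIntegrable_scaled_oscIntegrand hα).const_mul α).div_const √(3 / 2 * α)
  have hh := intervalIntegrable_constC₀.add (intervalIntegrable_constC₁.const_mul α)
  have := abs_integral_sub_integral_le (K := 50 * α ^ 2) hf hh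
    fun s hs => abs_small_integrand_sub_le hα hα8 hs
  rw [intervalIntegral.integral_div, intervalIntegral.integral_const_mul, ← timeMap_osc_eq,
    intervalIntegral.integral_add intervalIntegrable_constC₀
      (intervalIntegrable_constC₁.const_mul α), intervalIntegral.integral_const_mul] at this
  change |_ - (constC₀ + α * constC₁)| ≤ _ at this
  rw [mul_comm α constC₁] at this
  linarith

/-- The expansion of the bifurcation curve at `0`. -/
theorem isBigO_small :
    (fun α : ℝ => 2 * timeMap oscDiffusion oscReaction α ^ 2 / (3 * α)
      - (constC₀ ^ 2 + 2 * constC₀ * constC₁ * α)) =O[𝓝[>] 0] fun α : ℝ => α ^ 2 := by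
  obtain ⟨K, hK0, hK⟩ := exists_abs_timeMap_small_sub_le
  refine IsBigO.of_bound (K * (K + 2 * |constC₀| + 2 * |constC₁|) + constC₁ ^ 2) ?_
  filter_upwards [Ioo_mem_nhdsGT (show (0 : ℝ) < 1 / 8 by norm_num)] with α hα
  have h := hK α hα.1 hα.2.le
  have hα1 : α ≤ 1 := by linarith [hα.2]
  have hα0 : 0 < α := hα.1
  set T := timeMap oscDiffusion oscReaction α with hT
  have hpos : 0 < √(3 / 2 * α) := Real.sqrt_pos.2 (by positivity)
  set H := T / √(3 / 2 * α) with hH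
  have hTH : 2 * T ^ 2 / (3 * α) = H ^ 2 := by
    rw [hH, div_pow, Real.sq_sqrt (by positivity)]
    field_simp
  rw [hTH]
  set R := H - (constC₀ + constC₁ * α) with hR
  have : H ^ 2 - (constC₀ ^ 2 + 2 * constC₀ * constC₁ * α)
      = R * (R + 2 * constC₀ + 2 * constC₁ * α) + constC₁ ^ 2 * α ^ 2 := by
    rw [hR]
    ring
  rw [this, Real.norm_eq_abs, Real.norm_eq_abs, abs_of_nonneg (sq_nonneg α), add_mul]
  refine (abs_add_le _ _).trans (add_le_add ?_ ?_)
  · have h1 : |R| ≤ K := h.trans (mul_le_of_le_one_right hK0 (pow_le_one₀ hα0.le hα1))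
    have h2 : |constC₁| * α ≤ |constC₁| := mul_le_of_le_one_right (abs_nonneg _) hα1
    have h3 : |R + 2 * constC₀ + 2 * constC₁ * α| ≤ K + 2 * |constC₀| + 2 * |constC₁| := by
      refine (abs_add_three _ _ _).trans ?_
      rw [abs_mul, abs_mul, abs_mul, abs_two, abs_of_pos hα0]
      linarith
    rw [abs_mul]
    calc _ ≤ K * α ^ 2 * (K + 2 * |constC₀| + 2 * |constC₁|) :=
          mul_le_mul h h3 (abs_nonneg _) (by positivity)
      _ = _ := by ring
  · rw [abs_of_nonneg (by positivity)]

end Small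

/-! ### The oscillatory integral -/

noncomputable section

/-- The polynomial with `1 - (1 - r)⁴ = r * quarticQuotient r`. -/
def quarticQuotient (r : ℝ) : ℝ := 4 - 6 * r + 4 * r ^ 2 - r ^ 3

/-- The regular factor `(1 - r)² / quarticQuotient r ^ (3/2)` left over from
`s² / (1 - s⁴) ^ (3/2)` with `s = 1 - r` after the singularity `r ^ (-3/2)` is removed. -/
def oscWeight (r : ℝ) : ℝ := (1 - r) ^ 2 / (quarticQuotient r * √(quarticQuotient r))

/-- The integral carrying the leading oscillation of the time map at large amplitude. -/
def oscIntegral (α : ℝ) : ℝ :=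
  ∫ s in (0 : ℝ)..1, s ^ 2 * (Real.cos α - Real.cos (α * s)) / ((1 - s ^ 4) * √(1 - s ^ 4))

end

section OscillatoryIntegral

theorem one_le_quarticQuotient {r : ℝ} (hr : r ∈ Ioo (0 : ℝ) 1) : 1 ≤ quarticQuotient r := by
  have : quarticQuotient r - 1 = (1 - r) * (3 * (1 - r) + r ^ 2) := by
    unfold quarticQuotient; ring
  have h1 : 0 ≤ 1 - r := by linarith [hr.2]
  have : 0 ≤ (1 - r) * (3 * (1 - r) + r ^ 2) := by positivity
  linarith

theorem abs_oscWeight_le {r : ℝ} (hr : r ∈ Ioo (0 : ℝ) 1) : |oscWeight r| ≤ 1 := by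
  have h := one_le_quarticQuotient hr
  have h1 : 1 ≤ √(quarticQuotient r) := Real.one_le_sqrt.2 h
  have h2 : 1 ≤ quarticQuotient r * √(quarticQuotient r) := one_le_mul_of_one_le_of_one_le h h1
  have h3 : (1 - r) ^ 2 ≤ 1 := pow_le_one₀ (by linarith [hr.2]) (by linarith [hr.1])
  rw [oscWeight, abs_of_nonneg (by positivity), div_le_one (by positivity)]
  linarith

theorem measurable_oscWeight : Measurable oscWeight := by
  unfold oscWeight quarticQuotient
  fun_prop

theorem tendsto_oscWeight : Tendsto oscWeight (𝓝 0) (𝓝 (1 / 8)) := by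
  have h0 : quarticQuotient 0 = 4 := by norm_num [quarticQuotient]
  have h2 : √(4 : ℝ) = 2 := by
    rw [show (4 : ℝ) = 2 ^ 2 by norm_num, Real.sqrt_sq (by norm_num)]
  have hc : Continuous quarticQuotient := by unfold quarticQuotient; fun_prop
  have : ContinuousAt oscWeight 0 := by
    unfold oscWeight
    apply ContinuousAt.div (by fun_prop) (by fun_prop)
    rw [h0, h2]
    norm_num
  have h := this.tendsto
  rw [oscWeight, h0, h2] at h
  norm_num at h
  exact h

/-- Dominated convergence: on every bounded set the weight tends to its value `1 / 8` at `0`. -/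
theorem tendsto_integral_oscWeight {φ : ℝ → ℝ} (hφm : Measurable φ)
    (hφ : ∀ x, 0 < x → |φ x| ≤ 6 * (1 + x ^ 2)⁻¹) :
    Tendsto (fun α : ℝ => ∫ x in Ioo 0 √α, oscWeight (x ^ 2 / α) * φ x) atTop
      (𝓝 (1 / 8 * ∫ x in Ioi (0 : ℝ), φ x)) := by
  have hind : ∀ α : ℝ, ∫ x in Ioo 0 √α, oscWeight (x ^ 2 / α) * φ x
      = ∫ x in Ioi (0 : ℝ), (Ioo 0 √α).indicator (fun x => oscWeight (x ^ 2 / α) * φ x) x := by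
    intro α
    rw [setIntegral_indicator measurableSet_Ioo, inter_eq_self_of_subset_right Ioo_subset_Ioi_self]
  simp_rw [hind]
  rw [← integral_const_mul]
  apply tendsto_integral_filter_of_dominated_convergence _ _ _
    (integrableOn_inv_one_add_sq_const_mul 6)
  · refine ae_restrict_of_forall_mem measurableSet_Ioi fun x hx => ?_
    have h1 : Tendsto (fun α : ℝ => oscWeight (x ^ 2 / α) * φ x) atTop (𝓝 (1 / 8 * φ x)) :=
      (tendsto_oscWeight.comp (tendsto_const_nhds.div_atTop tendsto_id)).mul_const _
    apply h1.congr'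
    filter_upwards [eventually_gt_atTop (x ^ 2)] with α hα
    have : x ∈ Ioo 0 √α := ⟨hx, (Real.lt_sqrt (le_of_lt hx)).2 hα⟩
    rw [indicator_of_mem this]
  · refine Eventually.of_forall fun α => Measurable.aestronglyMeasurable ?_
    exact ((measurable_oscWeight.comp (by fun_prop)).mul hφm).indicator measurableSet_Ioo
  · refine Eventually.of_forall fun α => ae_restrict_of_forall_mem measurableSet_Ioi fun x hx => ?_
    by_cases h : x ∈ Ioo 0 √α
    · rw [indicator_of_mem h, norm_mul, Real.norm_eq_abs, Real.norm_eq_abs]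
      have hx0 : 0 < x := hx
      have hx2 : x ^ 2 < α := (Real.lt_sqrt hx0.le).1 h.2
      have hα : 0 < α := lt_of_le_of_lt (sq_nonneg x) hx2
      have hr : x ^ 2 / α ∈ Ioo (0 : ℝ) 1 := ⟨by positivity, (div_lt_one hα).2 hx2⟩
      calc _ ≤ 1 * (6 * (1 + x ^ 2)⁻¹) :=
            mul_le_mul (abs_oscWeight_le hr) (hφ x hx) (abs_nonneg _) zero_le_one
        _ = _ := one_mul _
    · rw [indicator_of_notMem h, norm_zero]
      positivity

/-- The substitution `s = 1 - x² / α`. -/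
theorem oscIntegral_eq {α : ℝ} (hα : 0 < α) :
    oscIntegral α = √α * ∫ x in Ioo 0 √α, oscWeight (x ^ 2 / α) *
      (2 * (Real.cos α * ((1 - Real.cos (x ^ 2)) / x ^ 2)
        - Real.sin α * (Real.sin (x ^ 2) / x ^ 2))) := by
  set f : ℝ → ℝ := fun x => 1 - x ^ 2 / α with hf
  have hx2 : ∀ x ∈ Ioo 0 √α, x ^ 2 < α := fun x hx => (Real.lt_sqrt hx.1.le).1 hx.2
  have hmem : ∀ x ∈ Ioo 0 √α, x ^ 2 / α ∈ Ioo (0 : ℝ) 1 := fun x hx =>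
    ⟨div_pos (pow_pos hx.1 2) hα, (div_lt_one hα).2 (hx2 x hx)⟩
  have himage : f '' Ioo 0 √α = Ioo 0 1 := by
    ext s
    constructor
    · rintro ⟨x, hx, rfl⟩
      have := hmem x hx
      exact ⟨by simp only [hf]; linarith [this.2], by simp only [hf]; linarith [this.1]⟩
    · rintro ⟨h0, h1⟩
      have hpos : 0 < α * (1 - s) := mul_pos hα (by linarith)
      refine ⟨√(α * (1 - s)), ⟨Real.sqrt_pos.2 hpos, Real.sqrt_lt_sqrt hpos.le (by nlinarith)⟩, ?_⟩
      simp only [hf]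
      rw [Real.sq_sqrt hpos.le]
      field_simp
      ring
  have hinj : InjOn f (Ioo 0 √α) := by
    intro x hx y hy hxy
    simp only [hf, sub_right_inj] at hxy
    rw [div_left_inj' hα.ne'] at hxy
    exact (pow_left_inj₀ hx.1.le hy.1.le two_ne_zero).1 hxy
  have hderiv : ∀ x ∈ Ioo 0 √α, HasDerivWithinAt f (-(2 * x / α)) (Ioo 0 √α) x := by
    intro x _
    have := ((hasDerivAt_pow 2 x).div_const α).const_sub 1
    simpa using this.hasDerivWithinAt
  rw [oscIntegral, intervalIntegral.integral_of_le zero_le_one, integral_Ioc_eq_integral_Ioo,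
    ← himage, integral_image_eq_integral_abs_deriv_smul measurableSet_Ioo hderiv hinj,
    ← integral_const_mul]
  apply setIntegral_congr_fun measurableSet_Ioo
  intro x hx
  have hx0 : 0 < x := hx.1
  have hq : 0 < quarticQuotient (x ^ 2 / α) :=
    zero_lt_one.trans_le (one_le_quarticQuotient (hmem x hx))
  have h4 : 1 - f x ^ 4 = x ^ 2 / α * quarticQuotient (x ^ 2 / α) := by
    simp only [hf, quarticQuotient]; ring
  have hsqrt : √(1 - f x ^ 4) = x / √α * √(quarticQuotient (x ^ 2 / α)) := by
    rw [h4, Real.sqrt_mul (by positivity), Real.sqrt_div (by positivity), Real.sqrt_sq hx0.le]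
  have hcos : Real.cos (α * f x)
      = Real.cos α * Real.cos (x ^ 2) + Real.sin α * Real.sin (x ^ 2) := by
    rw [← Real.cos_sub]
    congr 1
    simp only [hf]
    field_simp
  have hα' : 0 < √α := Real.sqrt_pos.2 hα
  have hQ : 0 < √(quarticQuotient (x ^ 2 / α)) := Real.sqrt_pos.2 hq
  simp only
  rw [abs_neg, abs_of_pos (by positivity), smul_eq_mul, hsqrt, h4, hcos, oscWeight]
  simp only [hf]
  generalize quarticQuotient (x ^ 2 / α) = q at hq hQ
  generalize Real.cos (x ^ 2) = c
  generalize Real.sin (x ^ 2) = s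
  field_simp
  ring

/-- The leading oscillation: both Fresnel integrals equal `√(π/2)`. -/
theorem tendsto_oscIntegral :
    Tendsto (fun α => oscIntegral α / √α + √Real.pi / 4 * Real.sin (α - Real.pi / 4))
      atTop (𝓝 0) := by
  set A : ℝ → ℝ := fun α =>
    ∫ x in Ioo 0 √α, oscWeight (x ^ 2 / α) * ((1 - Real.cos (x ^ 2)) / x ^ 2)
  set B : ℝ → ℝ := fun α =>
    ∫ x in Ioo 0 √α, oscWeight (x ^ 2 / α) * (Real.sin (x ^ 2) / x ^ 2)
  have hA : Tendsto A atTop (𝓝 (1 / 8 * √(Real.pi / 2))) := by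
    rw [← integral_one_sub_cos_sq_div_sq]
    exact tendsto_integral_oscWeight (by fun_prop) fun x hx => (abs_fresnel_le hx).1
  have hB : Tendsto B atTop (𝓝 (1 / 8 * √(Real.pi / 2))) := by
    rw [← integral_sin_sq_div_sq]
    exact tendsto_integral_oscWeight (by fun_prop) fun x hx => (abs_fresnel_le hx).2
  have hint : ∀ (α : ℝ) {φ : ℝ → ℝ}, 0 < α → Measurable φ →
      (∀ x, 0 < x → |φ x| ≤ 6 * (1 + x ^ 2)⁻¹) →
      IntegrableOn (fun x => oscWeight (x ^ 2 / α) * φ x) (Ioo 0 √α) := by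
    intro α φ hα hm hφ
    refine ((integrableOn_inv_one_add_sq_const_mul 6).mono_set Ioo_subset_Ioi_self).mono'
      ((measurable_oscWeight.comp (by fun_prop)).mul hm).aestronglyMeasurable
      (ae_restrict_of_forall_mem measurableSet_Ioo fun x hx => ?_)
    have hr : x ^ 2 / α ∈ Ioo (0 : ℝ) 1 :=
      ⟨div_pos (pow_pos hx.1 2) hα, (div_lt_one hα).2 ((Real.lt_sqrt hx.1.le).1 hx.2)⟩
    rw [norm_mul, Real.norm_eq_abs, Real.norm_eq_abs]
    calc _ ≤ 1 * (6 * (1 + x ^ 2)⁻¹) :=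
          mul_le_mul (abs_oscWeight_le hr) (hφ x hx.1) (abs_nonneg _) zero_le_one
      _ = _ := one_mul _
  have hJ : ∀ α, 0 < α →
      oscIntegral α / √α = 2 * (Real.cos α * A α - Real.sin α * B α) := by
    intro α hα
    rw [oscIntegral_eq hα, mul_div_cancel_left₀ _ (Real.sqrt_pos.2 hα).ne']
    have h1 := hint α (φ := fun x => (1 - Real.cos (x ^ 2)) / x ^ 2) hα (by fun_prop)
      fun x hx => (abs_fresnel_le hx).1
    have h2 := hint α (φ := fun x => Real.sin (x ^ 2) / x ^ 2) hα (by fun_prop)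
      fun x hx => (abs_fresnel_le hx).2
    rw [← integral_const_mul, ← integral_const_mul, ← integral_sub (h1.const_mul _)
      (h2.const_mul _), ← integral_const_mul]
    congr 1
    ext x
    ring
  have hlim : Tendsto (fun α => 2 * (Real.cos α * (A α - 1 / 8 * √(Real.pi / 2))
      - Real.sin α * (B α - 1 / 8 * √(Real.pi / 2)))) atTop (𝓝 0) := by
    have hA' : Tendsto (fun α => Real.cos α * (A α - 1 / 8 * √(Real.pi / 2))) atTop (𝓝 0) := by
      apply isBoundedUnder_le_mul_tendsto_zero
      · exact isBoundedUnder_of ⟨1, fun α => Real.abs_cos_le_one α⟩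
      · simpa using hA.sub_const (1 / 8 * √(Real.pi / 2))
    have hB' : Tendsto (fun α => Real.sin α * (B α - 1 / 8 * √(Real.pi / 2))) atTop (𝓝 0) := by
      apply isBoundedUnder_le_mul_tendsto_zero
      · exact isBoundedUnder_of ⟨1, fun α => Real.abs_sin_le_one α⟩
      · simpa using hB.sub_const (1 / 8 * √(Real.pi / 2))
    simpa using (hA'.sub hB').const_mul 2
  apply hlim.congr'
  filter_upwards [eventually_gt_atTop 0] with α hα
  have h2 : √(2 : ℝ) ^ 2 = 2 := Real.sq_sqrt (by norm_num)
  have h6 : √(Real.pi / 2) = √Real.pi * (√2 / 2) := by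
    rw [Real.sqrt_div Real.pi_pos.le, div_eq_iff (by positivity)]
    linear_combination (-√Real.pi / 2) * h2
  rw [hJ α hα, Real.sin_sub, Real.cos_pi_div_four, Real.sin_pi_div_four, h6]
  ring

end OscillatoryIntegral

/-! ### Large amplitudes -/

section Large

/-- The potential is `u⁴ / 4 - u² cos u` up to a function with derivative `O(u)`. -/
theorem abs_oscPotential_sub_large_le {α v : ℝ} (hv : 0 ≤ v) (hvα : v ≤ α) (hα : 1 ≤ α) :
    |oscPotential α - oscPotential v
      - ((α ^ 4 - v ^ 4) / 4 - (α ^ 2 * Real.cos α - v ^ 2 * Real.cos v))| ≤ 4 * α * (α - v) := by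
  have hd : ∀ x ∈ Icc v α,
      HasDerivWithinAt (fun x => oscPotential x - (x ^ 4 / 4 - x ^ 2 * Real.cos x))
      (x * Real.sin x + Real.sin x ^ 2 + 2 * (x * Real.cos x)) (Icc v α) x := by
    intro x _
    have := (hasDerivAt_oscPotential x).sub
      (((hasDerivAt_pow 4 x).div_const 4).sub ((hasDerivAt_pow 2 x).mul (Real.hasDerivAt_cos x)))
    apply HasDerivAt.hasDerivWithinAt
    convert! this using 1
    unfold oscDiffusion oscReaction
    push_cast
    ring
  have := (convex_Icc v α).norm_image_sub_le_of_norm_hasDerivWithin_le (C := 4 * α) hd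
    (fun x hx => by
      have hx0 : 0 ≤ x := hv.trans hx.1
      have h1 : |x * Real.sin x| ≤ x := by
        rw [abs_mul, abs_of_nonneg hx0]
        exact mul_le_of_le_one_right hx0 (Real.abs_sin_le_one x)
      have h2 : |x * Real.cos x| ≤ x := by
        rw [abs_mul, abs_of_nonneg hx0]
        exact mul_le_of_le_one_right hx0 (Real.abs_cos_le_one x)
      have h3 : |Real.sin x ^ 2| ≤ 1 := by
        rw [abs_of_nonneg (sq_nonneg _)]
        exact Real.sin_sq_le_one x
      rw [Real.norm_eq_abs]
      refine (abs_add_three _ _ _).trans ?_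
      rw [abs_mul 2, abs_two]
      linarith [hx.2]) (left_mem_Icc.2 hvα) (right_mem_Icc.2 hvα)
  rw [Real.norm_eq_abs, Real.norm_eq_abs, abs_of_nonneg (sub_nonneg.2 hvα)] at this
  convert! this using 2
  ring

theorem abs_cos_sub_cos_div_le {α s : ℝ} (hα : 0 < α) (hs : s ∈ Ioo (0 : ℝ) 1) :
    |(Real.cos α - Real.cos (α * s)) / (1 - s ^ 4)| ≤ α := by
  have hw : 1 - s ≤ 1 - s ^ 4 := one_sub_le_one_sub_pow hs four_ne_zero
  have h4 : 0 < 1 - s ^ 4 := by linarith [hs.2]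
  have h : |Real.cos α - Real.cos (α * s)| ≤ |α - α * s| := by
    have := Real.lipschitzWith_cos.dist_le_mul α (α * s)
    simpa [Real.dist_eq] using this
  rw [abs_div, abs_of_pos h4, div_le_iff₀ h4]
  refine h.trans ?_
  rw [show α - α * s = α * (1 - s) by ring, abs_of_nonneg (mul_nonneg hα.le (by linarith [hs.2]))]
  gcongr

/-- The integrand of the time map, divided by `2α`, up to `O(α⁻²)`. -/
theorem abs_large_integrand_sub_le {α s : ℝ} (hα : 48 ≤ α) (hs : s ∈ Ioo (0 : ℝ) 1) :
    |oscDiffusion (α * s) / √(oscPotential α - oscPotential (α * s)) / 2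
      - (s ^ 2 / √(1 - s ^ 4) + 2 / α ^ 2 *
        (s ^ 2 * (Real.cos α - Real.cos (α * s)) / ((1 - s ^ 4) * √(1 - s ^ 4))))|
      ≤ 588 / α ^ 2 * (√(1 - s))⁻¹ := by
  have hα0 : 0 < α := by linarith
  obtain ⟨h0, h1⟩ := hs
  have hs2 : s ^ 2 ≤ 1 := pow_le_one₀ h0.le h1.le
  have hw4 : 1 - s ≤ 1 - s ^ 4 := one_sub_le_one_sub_pow ⟨h0, h1⟩ four_ne_zero
  have h4 : 0 < 1 - s ^ 4 := by linarith
  have hb : |(Real.cos α - Real.cos (α * s)) / (1 - s ^ 4)| ≤ α :=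
    abs_cos_sub_cos_div_le hα0 ⟨h0, h1⟩
  set b := (Real.cos α - Real.cos (α * s)) / (1 - s ^ 4) with hb_def
  have hbmul : Real.cos α - Real.cos (α * s) = b * (1 - s ^ 4) := by rw [hb_def]; field_simp
  set E := oscPotential α - oscPotential (α * s)
      - ((α ^ 4 - (α * s) ^ 4) / 4 - (α ^ 2 * Real.cos α - (α * s) ^ 2 * Real.cos (α * s))) with hE
  have hEle : |E| ≤ 4 * α * (α - α * s) := abs_oscPotential_sub_large_le (by positivity)
    (mul_le_of_le_one_right hα0.le h1.le) (by linarith)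
  set m := -(4 / α ^ 2 * b) with hm
  set e₁ := (1 - s ^ 2) / (1 - s ^ 4) * Real.cos (α * s) with he₁
  set e₂ := E / (α ^ 2 * (1 - s ^ 4)) with he₂
  set e := 4 / α ^ 2 * (e₂ - e₁) with he
  have hpot : oscPotential α - oscPotential (α * s)
      = α ^ 4 / 4 * ((1 - s ^ 4) * (1 + (m + e))) := by
    have h5 : E = e₂ * (α ^ 2 * (1 - s ^ 4)) := by rw [he₂]; field_simp
    have h6 : (1 - s ^ 2) * Real.cos (α * s) = e₁ * (1 - s ^ 4) := by rw [he₁]; field_simp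
    have h7 : oscPotential α - oscPotential (α * s) = E + ((α ^ 4 - (α * s) ^ 4) / 4
        - (α ^ 2 * Real.cos α - (α * s) ^ 2 * Real.cos (α * s))) := by rw [hE]; ring
    have h8 : α ^ 4 / 4 * ((1 - s ^ 4) * (1 + (m + e)))
        = α ^ 4 / 4 * (1 - s ^ 4) + α ^ 2 * (1 - s ^ 4) * (-b + e₂ - e₁) := by
      rw [hm, he]
      field_simp
      ring
    rw [h8, h7, h5]
    linear_combination (-α ^ 2) * hbmul - α ^ 2 * h6
  have he₁le : |e₁| ≤ 1 := by
    have h5 : 0 ≤ 1 - s ^ 2 := by linarith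
    have h6 : (1 - s ^ 2) / (1 - s ^ 4) ≤ 1 := by
      rw [div_le_one h4]
      have : s ^ 4 ≤ s ^ 2 := pow_le_pow_of_le_one h0.le h1.le (by norm_num)
      linarith
    rw [he₁, abs_mul, abs_of_nonneg (by positivity : 0 ≤ (1 - s ^ 2) / (1 - s ^ 4))]
    exact mul_le_one₀ h6 (abs_nonneg _) (Real.abs_cos_le_one _)
  have he₂le : |e₂| ≤ 4 := by
    rw [he₂, abs_div, abs_of_pos (by positivity : 0 < α ^ 2 * (1 - s ^ 4)),
      div_le_iff₀ (by positivity)]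
    refine hEle.trans ?_
    calc 4 * α * (α - α * s) = 4 * (α ^ 2 * (1 - s)) := by ring
      _ ≤ 4 * (α ^ 2 * (1 - s ^ 4)) := by gcongr
  have hele : |e| ≤ 20 / α ^ 2 := by
    rw [he, abs_mul, abs_of_nonneg (by positivity : 0 ≤ 4 / α ^ 2)]
    calc 4 / α ^ 2 * |e₂ - e₁| ≤ 4 / α ^ 2 * 5 := by
          gcongr
          exact (abs_sub _ _).trans (by linarith)
      _ = _ := by ring
  have hmle : |m| ≤ 4 / α := by
    rw [hm, abs_neg, abs_mul, abs_of_nonneg (by positivity : 0 ≤ 4 / α ^ 2)]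
    calc 4 / α ^ 2 * |b| ≤ 4 / α ^ 2 * α := by gcongr
      _ = 4 / α := by field_simp
  have hme : |m + e| ≤ 24 / α := by
    have h5 : 20 / α ^ 2 ≤ 20 / α := by
      apply div_le_div_of_nonneg_left (by norm_num) hα0
      rw [sq]
      exact le_mul_of_one_le_left hα0.le (by linarith)
    refine (abs_add_le _ _).trans ?_
    calc |m| + |e| ≤ 4 / α + 20 / α := add_le_add hmle (hele.trans h5)
      _ = 24 / α := by ring
  have hme2 : (m + e) ^ 2 ≤ 576 / α ^ 2 := by
    rw [← sq_abs]
    calc |m + e| ^ 2 ≤ (24 / α) ^ 2 := pow_le_pow_left₀ (abs_nonneg _) hme 2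
      _ = 576 / α ^ 2 := by ring
  set d := Real.sin (α * s) / α ^ 2 with hd
  have hdle : |d| ≤ 1 / α ^ 2 := by
    rw [hd, abs_div, abs_of_pos (by positivity : 0 < α ^ 2)]
    gcongr
    exact Real.abs_sin_le_one _
  have hD : oscDiffusion (α * s) = α ^ 2 * (s ^ 2 + d) := by
    unfold oscDiffusion
    rw [hd]
    field_simp
  have hmain := abs_mul_inv_sqrt_sub_le (n := s ^ 2) (d := d) (m := m) (e := e)
    (hme.trans (by rw [div_le_iff₀ hα0]; linarith))
  have hscale : oscDiffusion (α * s) / √(oscPotential α - oscPotential (α * s)) / 2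
      = (s ^ 2 + d) * (√(1 + (m + e)))⁻¹ * (√(1 - s ^ 4))⁻¹ := by
    have h5 : √(α ^ 4 / 4) = α ^ 2 / 2 := by
      rw [show α ^ 4 / 4 = (α ^ 2 / 2) ^ 2 by ring, Real.sqrt_sq (by positivity)]
    rw [hpot, hD, Real.sqrt_mul (by positivity), Real.sqrt_mul h4.le, h5]
    field_simp
  have htarget : s ^ 2 / √(1 - s ^ 4) + 2 / α ^ 2 *
        (s ^ 2 * (Real.cos α - Real.cos (α * s)) / ((1 - s ^ 4) * √(1 - s ^ 4)))
      = (s ^ 2 - s ^ 2 * m / 2) * (√(1 - s ^ 4))⁻¹ := by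
    have h5 : s ^ 2 * (Real.cos α - Real.cos (α * s)) / ((1 - s ^ 4) * √(1 - s ^ 4))
        = s ^ 2 * b * (√(1 - s ^ 4))⁻¹ := by
      rw [hb_def]; field_simp
    rw [h5, hm]
    ring
  rw [hscale, htarget, ← sub_mul, abs_mul, abs_of_nonneg (inv_nonneg.2 (Real.sqrt_nonneg _))]
  refine mul_le_mul ?_ (inv_sqrt_le_inv_sqrt_one_sub h1 hw4) (by positivity) (by positivity)
  refine hmain.trans ?_
  have hprod : |s ^ 2| * (|e| / 2 + (m + e) ^ 2) ≤ 1 * (20 / α ^ 2 / 2 + 576 / α ^ 2) := by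
    rw [abs_of_nonneg (by positivity : 0 ≤ s ^ 2)]
    gcongr
  calc _ ≤ 1 * (20 / α ^ 2 / 2 + 576 / α ^ 2) + 2 * (1 / α ^ 2) := by gcongr
    _ = 588 / α ^ 2 := by ring

theorem intervalIntegrable_constA :
    IntervalIntegrable (fun s : ℝ => s ^ 2 / √(1 - s ^ 4)) volume 0 1 := by
  refine intervalIntegrable_of_abs_le_inv_sqrt (K := 1) zero_le_one (by fun_prop) fun s hs => ?_
  rw [abs_of_nonneg (div_nonneg (sq_nonneg s) (Real.sqrt_nonneg _)), div_eq_mul_inv]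
  exact mul_le_mul (pow_le_one₀ hs.1.le hs.2.le) (inv_sqrt_le_inv_sqrt_one_sub hs.2
    (one_sub_le_one_sub_pow hs four_ne_zero)) (by positivity) zero_le_one

theorem intervalIntegrable_oscIntegral {α : ℝ} (hα : 0 < α) :
    IntervalIntegrable (fun s : ℝ =>
      s ^ 2 * (Real.cos α - Real.cos (α * s)) / ((1 - s ^ 4) * √(1 - s ^ 4))) volume 0 1 := by
  refine intervalIntegrable_of_abs_le_inv_sqrt (K := α) zero_le_one (by fun_prop) fun s hs => ?_
  have h : s ^ 2 * (Real.cos α - Real.cos (α * s)) / ((1 - s ^ 4) * √(1 - s ^ 4))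
      = s ^ 2 * ((Real.cos α - Real.cos (α * s)) / (1 - s ^ 4)) * (√(1 - s ^ 4))⁻¹ := by
    rw [mul_div_mul_comm]
    ring
  rw [h, abs_mul, abs_mul, abs_of_nonneg (inv_nonneg.2 (Real.sqrt_nonneg _)),
    abs_of_nonneg (sq_nonneg s)]
  refine mul_le_mul ?_ (inv_sqrt_le_inv_sqrt_one_sub hs.2
    (one_sub_le_one_sub_pow hs four_ne_zero)) (by positivity) hα.le
  calc _ ≤ 1 * α := mul_le_mul (pow_le_one₀ hs.1.le hs.2.le) (abs_cos_sub_cos_div_le hα hs)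
        (abs_nonneg _) zero_le_one
    _ = α := one_mul α

/-- The time map for large amplitudes, in terms of the oscillatory integral. -/
theorem exists_abs_timeMap_large_sub_le :
    ∃ K, ∀ α, 48 ≤ α →
      |timeMap oscDiffusion oscReaction α / (2 * α) - (constA 2 2 + 2 / α ^ 2 * oscIntegral α)|
        ≤ K / α ^ 2 := by
  refine ⟨588 * ∫ s in (0 : ℝ)..1, (√(1 - s))⁻¹, fun α hα => ?_⟩
  have hα0 : 0 < α := by linarith
  have hf := (intervalIntegrable_scaled_oscIntegrand hα0).div_const 2
  have hh := intervalIntegrable_constA.add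
    ((intervalIntegrable_oscIntegral hα0).const_mul (2 / α ^ 2))
  have := abs_integral_sub_integral_le (K := 588 / α ^ 2) hf hh
    fun s hs => abs_large_integrand_sub_le hα hs
  rw [intervalIntegral.integral_div,
    intervalIntegral.integral_add intervalIntegrable_constA
      ((intervalIntegrable_oscIntegral hα0).const_mul (2 / α ^ 2)),
    intervalIntegral.integral_const_mul] at this
  rw [timeMap_osc_eq, mul_comm 2 α, mul_div_mul_left _ _ hα0.ne', ← div_mul_eq_mul_div]
  exact this

/-- The expansion of the bifurcation curve at infinity. -/
theorem isLittleO_large :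
    (fun α : ℝ => 2 * timeMap oscDiffusion oscReaction α ^ 2 / (8 * α ^ 2)
      - (constA 2 2 ^ 2
        - constA 2 2 * √Real.pi * α ^ (-(3 / 2) : ℝ) * Real.sin (α - Real.pi / 4)))
      =o[atTop] fun α : ℝ => α ^ (-(3 / 2) : ℝ) := by
  obtain ⟨K, hK⟩ := exists_abs_timeMap_large_sub_le
  have hneg : Tendsto (fun α : ℝ => α ^ (-(3 / 2) : ℝ)) atTop (𝓝 0) :=
    tendsto_rpow_neg_atTop (by norm_num)
  -- The relative correction `X(α) - A` and its deviation from the oscillating term.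
  set X : ℝ → ℝ := fun α => timeMap oscDiffusion oscReaction α / (2 * α) - constA 2 2 with hX
  set S : ℝ → ℝ := fun α => √Real.pi / 2 * Real.sin (α - Real.pi / 4) with hS
  have hdev : (fun α => X α + α ^ (-(3 / 2) : ℝ) * S α) =o[atTop]
      fun α : ℝ => α ^ (-(3 / 2) : ℝ) := by
    have h1 : (fun α => X α - 2 / α ^ 2 * oscIntegral α) =o[atTop]
        fun α : ℝ => α ^ (-(3 / 2) : ℝ) := by
      have hO : (fun α => X α - 2 / α ^ 2 * oscIntegral α) =O[atTop]
          fun α : ℝ => α ^ (-2 : ℝ) := by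
        refine IsBigO.of_bound K ?_
        filter_upwards [eventually_ge_atTop 48] with α hα
        have hα0 : 0 < α := by linarith
        have := hK α hα
        rw [Real.norm_eq_abs, Real.norm_eq_abs, abs_of_nonneg (by positivity : 0 ≤ α ^ (-2 : ℝ)),
          Real.rpow_neg hα0.le, Real.rpow_two, ← div_eq_mul_inv]
        convert! this using 2
        simp only [hX]
        ring
      refine hO.trans_isLittleO ?_
      have h2 : (fun α : ℝ => α ^ (-(1 / 2) : ℝ) * α ^ (-(3 / 2) : ℝ)) =o[atTop]
          fun α : ℝ => 1 * α ^ (-(3 / 2) : ℝ) :=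
        ((isLittleO_one_iff ℝ).2 (tendsto_rpow_neg_atTop (by norm_num))).mul_isBigO
          (isBigO_refl _ _)
      simp only [one_mul] at h2
      refine h2.congr' ?_ EventuallyEq.rfl
      filter_upwards [eventually_gt_atTop 0] with α hα
      rw [← Real.rpow_add hα]
      norm_num
    have h2 : (fun α => 2 / α ^ 2 * oscIntegral α + α ^ (-(3 / 2) : ℝ) * S α) =o[atTop]
        fun α : ℝ => α ^ (-(3 / 2) : ℝ) := by
      have h3 : (fun α => (2 * (oscIntegral α / √α + √Real.pi / 4 * Real.sin (α - Real.pi / 4)))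
          * α ^ (-(3 / 2) : ℝ)) =o[atTop] fun α : ℝ => 1 * α ^ (-(3 / 2) : ℝ) := by
        refine IsLittleO.mul_isBigO ?_ (isBigO_refl _ _)
        rw [isLittleO_one_iff]
        simpa using tendsto_oscIntegral.const_mul 2
      simp only [one_mul] at h3
      refine h3.congr' ?_ EventuallyEq.rfl
      filter_upwards [eventually_gt_atTop 0] with α hα
      have h4 : α ^ (-(3 / 2) : ℝ) = √α / α ^ 2 := by
        rw [Real.sqrt_eq_rpow, ← Real.rpow_two, ← Real.rpow_sub hα]
        norm_num
      have h5 : 0 < √α := Real.sqrt_pos.2 hα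
      simp only [hS]
      rw [h4]
      field_simp
      ring
    refine (h1.add h2).congr_left fun α => ?_
    ring
  have hXO : X =O[atTop] fun α : ℝ => α ^ (-(3 / 2) : ℝ) := by
    have hSO : (fun α => α ^ (-(3 / 2) : ℝ) * S α) =O[atTop]
        fun α : ℝ => α ^ (-(3 / 2) : ℝ) := by
      refine IsBigO.of_bound (√Real.pi / 2) (Eventually.of_forall fun α => ?_)
      rw [norm_mul, mul_comm]
      gcongr
      simp only [hS]
      rw [norm_mul, Real.norm_eq_abs, Real.norm_eq_abs, abs_of_nonneg (by positivity)]
      exact mul_le_of_le_one_right (by positivity) (Real.abs_sin_le_one _)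
    exact (hdev.isBigO.sub hSO).congr_left fun α => by ring
  have hXsq : (fun α => X α * X α) =o[atTop] fun α : ℝ => α ^ (-(3 / 2) : ℝ) := by
    have := hXO.mul_isLittleO (hXO.trans_tendsto hneg |> (isLittleO_one_iff ℝ).2)
    simpa using this
  refine (hXsq.add (hdev.const_mul_left (2 * constA 2 2))).congr' ?_ EventuallyEq.rfl
  filter_upwards [eventually_gt_atTop 0] with α hα
  have h1 : 2 * timeMap oscDiffusion oscReaction α ^ 2 / (8 * α ^ 2) = (X α + constA 2 2) ^ 2 := by
    simp only [hX]
    field_simp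
    ring
  rw [h1]
  simp only [hS]
  ring

end Large

theorem theorem1p3 :
    ∃ lam : ℝ → ℝ,
      IsBifurcationCurve (fun u => u ^ 2 + Real.sin u) (fun u => u + Real.sin u) lam ∧
      (∃ r : ℝ → ℝ, r =o[atTop] (fun α : ℝ => α ^ (-(3 / 2) : ℝ)) ∧
        ∀ α : ℝ, 0 < α →
          lam α = 8 * α ^ 2 *
            (constA 2 2 ^ 2
              - constA 2 2 * √Real.pi * α ^ (-(3 / 2) : ℝ) * Real.sin (α - Real.pi / 4)
              + r α)) ∧
      (∃ r : ℝ → ℝ, r =O[𝓝[>] 0] (fun α : ℝ => α ^ 2) ∧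
        ∀ α : ℝ, 0 < α →
          lam α = 3 * α * (constC₀ ^ 2 + 2 * constC₀ * constC₁ * α + r α)) := by
  refine ⟨fun α => 2 * timeMap oscDiffusion oscReaction α ^ 2,
    isAdmissible_osc.isBifurcationCurve fun α hα => intervalIntegrable_oscIntegrand hα,
    ⟨_, isLittleO_large, fun α hα => ?_⟩, ⟨_, isBigO_small, fun α hα => ?_⟩⟩
  · rw [add_sub_cancel, mul_div_cancel₀ _ (by positivity)]
  · rw [add_sub_cancel, mul_div_cancel₀ _ (by positivity)]
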